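/- Let $\kappa>0$, let $B_1\subset\mathbb R^2$ be the open unit disk and $Y=[0,2\pi)\times\mathbb R$ with Lebesgue measure. All inner products are linear in the first argument. Equip $H^1(B_1)$ with $(u,v)_{\mathcal B}=(u,v)_{L^2(B_1)}+\kappa^{-2}(\nabla u,\nabla v)_{L^2(B_1)}$, and let $\mathcal B\subset H^1(B_1)$ be the closed span of the circular waves $(r,\theta)\mapsto J_p(\kappa r)e^{ip\theta}$, $p\in\mathbb Z$. For $\mathbf y=(\varphi,\zeta)\in Y$ put $$\phi_{\mathbf y}(\mathbf x)=e^{i\kappa\,\mathbf d(\mathbf y)\cdot\mathbf x},\quad \mathbf d(\mathbf y)=(\cos(\varphi+i\zeta),\sin(\varphi+i\zeta)),\qquad w(\mathbf y)=e^{-\kappa\sinh|\zeta|+|\zeta|/4}.$$ Let $\tilde a_p(\mathbf y)=e^{p\zeta}e^{ip\varphi}$ and $a_p=\tilde a_p/\|\tilde a_p\|_{L^2(Y;w^2)}$ for $p\in\mathbb Z$, and let $\mathcal A$ (the Herglotz densities) be the closed span of $\{a_p\}_{p\in\mathbb Z}$ in $L^2(Y;w^2)$, with its inner product $(\cdot,\cdot)_{\mathcal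 A}$. Then the following hold. 1. The Herglotz transform $(Tv)(\mathbf x)=\int_Y v(\mathbf y)\phi_{\mathbf y}(\mathbf x)w^2(\mathbf y)\,d\mathbf y$, $\mathbf x\in B_1$ (an absolutely convergent integral), defines a bounded operator $T:\mathcal A\to\mathcal B$; every $\phi_{\mathbf y}$ (restricted to $B_1$) belongs to $\mathcal B$; the frame operator $S=TT^*$ is boundedly invertible on $\mathcal B$; and the range of the analysis operator $T^*:\mathcal B\to\mathcal A$ is $\mathcal A$. 2. The space $\mathcal A$ is a reproducing kernel Hilbert space of functions on $Y$: representing $v=T^*u$, $u\in\mathcal B$, by the function $v(\mathbf y)=(u,\phi_{\mathbf y})_{\mathcal B}$, $\mathbf y\in Y$, is a well-defined injective linear realization of the elements of $\mathcal A$ as functions on $Y$, this function is a representative of the class $v\in L^2(Y;w^2)$, and for every $\mathbf y\in Y$ the evaluation $v\mapsto v(\mathbf y)$ is continuous on $\mathcal A$. 3. For every $\mathbf y\in Y$ there is a unique $K_{\mathbf y}\in\mathcal A$ with $v(\mathbf y)=(v,K_{\mathbf y})_{\mathcal A}$ for all $v\in\mathcal A$, and the reproducing kernel $K$ satisfies,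 for all $\mathbf y,\mathbf z\in Y$, $$K(\mathbf z,\mathbf y)=K_{\mathbf y}(\mathbf z)=(K_{\mathbf y},K_{\mathbf z})_{\mathcal A}=(\phi_{\mathbf y},S^{-1}\phi_{\mathbf z})_{\mathcal B}=\sum_{p\in\mathbb Z}\overline{a_p(\mathbf y)}\,a_p(\mathbf z),$$ where the series converges (absolutely) for all $\mathbf y,\mathbf z\in Y$. -/

import Mathlib

noncomputable section

namespace EvanescentWaves

open MeasureTheory Set

open scoped ContDiff ComplexConjugate

/-! ### The unit disk, the space `H¹` and the Helmholtz solution space -/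

/-- The Euclidean plane. -/
abbrev Plane : Type := EuclideanSpace ℝ (Fin 2)

/-- Lebesgue measure on the open unit disk. -/
def diskMeasure : Measure Plane := volume.restrict (Metric.ball 0 1)

/-- `L²` of the unit disk, scalar valued. -/
abbrev DiskL2 : Type := Lp ℂ 2 diskMeasure

/-- `L²` of the unit disk, with values in `ℂ²`. -/
abbrev DiskL2Vec : Type := Lp (EuclideanSpace ℂ (Fin 2)) 2 diskMeasure

/-- `g` is the weak gradient of `u` on the unit disk: integration by parts holds against all
smooth functions with compact support in the disk. -/
def HasWeakGradient (u : Plane → ℂ) (g : Plane → EuclideanSpace ℂ (Fin 2)) : Prop :=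
  ∀ ψ : Plane → ℝ, ContDiff ℝ ∞ ψ → HasCompactSupport ψ → tsupport ψ ⊆ Metric.ball 0 1 →
    ∀ i : Fin 2,
      ∫ x, ((fderiv ℝ ψ x (EuclideanSpace.single i 1) : ℝ) : ℂ) * u x ∂diskMeasure
        = - ∫ x, (ψ x : ℂ) * g x i ∂diskMeasure

/-- For pairs of `L²` functions, the weak gradient condition against one test function is a
linear relation between two inner products. -/
theorem exists_inner_repr {ψ : Plane → ℝ} (hψ : ContDiff ℝ ∞ ψ) (hc : HasCompactSupport ψ)
    (i : Fin 2) :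
    ∃ (f₁ : DiskL2) (f₂ : DiskL2Vec),
      (∀ u : DiskL2, ∫ x, ((fderiv ℝ ψ x (EuclideanSpace.single i 1) : ℝ) : ℂ) * u x ∂diskMeasure
        = inner ℂ f₁ u) ∧
      ∀ (κ : ℝ) (g : DiskL2Vec),
        ∫ x, (ψ x : ℂ) * ((κ : ℂ) • g x) i ∂diskMeasure = (κ : ℂ) * inner ℂ f₂ g := by
  have hψ' : Continuous fun x => fderiv ℝ ψ x (EuclideanSpace.single i 1) :=
    (hψ.continuous_fderiv (by simp)).clm_apply continuous_const
  have hc' : HasCompactSupport fun x => fderiv ℝ ψ x (EuclideanSpace.single i 1) :=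
    hc.fderiv_apply (𝕜 := ℝ) (EuclideanSpace.single i 1)
  have hfin : IsFiniteMeasureOnCompacts diskMeasure := by
    unfold diskMeasure; infer_instance
  have h₁ : MemLp (fun x => ((fderiv ℝ ψ x (EuclideanSpace.single i 1) : ℝ) : ℂ)) 2 diskMeasure :=
    Continuous.memLp_of_hasCompactSupport (Complex.continuous_ofReal.comp hψ')
      (hc'.comp_left (g := fun t : ℝ => (t : ℂ)) Complex.ofReal_zero)
  have h₂ : MemLp (fun x => (ψ x : ℂ) • (EuclideanSpace.single i 1 : EuclideanSpace ℂ (Fin 2))) 2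
      diskMeasure :=
    Continuous.memLp_of_hasCompactSupport
      ((Complex.continuous_ofReal.comp hψ.continuous).smul continuous_const)
      (hc.comp_left (g := fun t : ℝ => (t : ℂ) • (EuclideanSpace.single i 1 :
        EuclideanSpace ℂ (Fin 2))) (by simp))
  refine ⟨h₁.toLp _, h₂.toLp _, fun u => ?_, fun κ g => ?_⟩
  · rw [L2.inner_def]
    refine integral_congr_ae ?_
    filter_upwards [h₁.coeFn_toLp] with x hx
    rw [hx, RCLike.inner_apply, Complex.conj_ofReal, mul_comm]
  · rw [L2.inner_def, ← integral_const_mul]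
    refine integral_congr_ae ?_
    filter_upwards [h₂.coeFn_toLp] with x hx
    rw [hx, inner_smul_left, EuclideanSpace.inner_single_left, Complex.conj_ofReal]
    simp
    ring

/-- The Sobolev space `H¹` of the unit disk with the `κ`-dependent inner product
`(u, v) + κ⁻² (∇u, ∇v)`. A function `u` is stored as the pair `(u, κ⁻¹ ∇u)`, so that this
inner product is the one of the `L²`-product of `L²` and `(L²)²`. The second component is
determined by the first one. -/
def H1 (κ : ℝ) : Submodule ℂ (WithLp 2 (DiskL2 × DiskL2Vec)) where
  carrier := {U | HasWeakGradient U.fst fun x => (κ : ℂ) • U.snd x}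
  zero_mem' := by
    intro ψ hψ hc _ i
    obtain ⟨f₁, f₂, h₁, h₂⟩ := exists_inner_repr hψ hc i
    rw [h₁, h₂]; simp
  add_mem' := by
    intro U V hU hV ψ hψ hc hs i
    obtain ⟨f₁, f₂, h₁, h₂⟩ := exists_inner_repr hψ hc i
    have h3 := hU ψ hψ hc hs i
    have h4 := hV ψ hψ hc hs i
    rw [h₁, h₂] at h3 h4 ⊢
    rw [WithLp.add_fst, WithLp.add_snd, inner_add_right, inner_add_right, h3, h4]; ring
  smul_mem' := by
    intro c U hU ψ hψ hc hs i
    obtain ⟨f₁, f₂, h₁, h₂⟩ := exists_inner_repr hψ hc i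
    have h3 := hU ψ hψ hc hs i
    rw [h₁, h₂] at h3 ⊢
    rw [WithLp.smul_fst, WithLp.smul_snd, inner_smul_right, inner_smul_right, h3]; ring

theorem isClosed_H1 (κ : ℝ) : IsClosed (H1 κ : Set (WithLp 2 (DiskL2 × DiskL2Vec))) := by
  have : (H1 κ : Set (WithLp 2 (DiskL2 × DiskL2Vec))) =
      {U | HasWeakGradient U.fst fun x => (κ : ℂ) • U.snd x} := rfl
  rw [this]
  simp only [HasWeakGradient, ofPred_forall]
  refine isClosed_iInter fun ψ => isClosed_iInter fun hψ => isClosed_iInter fun hc =>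
    isClosed_iInter fun _ => isClosed_iInter fun i => ?_
  obtain ⟨f₁, f₂, h₁, h₂⟩ := exists_inner_repr hψ hc i
  simp only [h₁, h₂]
  have c₁ : Continuous fun U : WithLp 2 (DiskL2 × DiskL2Vec) => U.fst :=
    (WithLp.fstL 2 ℂ DiskL2 DiskL2Vec).continuous
  have c₂ : Continuous fun U : WithLp 2 (DiskL2 × DiskL2Vec) => U.snd :=
    (WithLp.sndL 2 ℂ DiskL2 DiskL2Vec).continuous
  exact isClosed_eq (continuous_const.inner c₁)
    (continuous_const.mul (continuous_const.inner c₂)).neg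

instance instCompleteSpaceH1 (κ : ℝ) : CompleteSpace (H1 κ) :=
  (isClosed_H1 κ).completeSpace_coe

/-- The element `u` of `H¹` is (the class of) the function `f` on the disk. -/
def IsClassOf {κ : ℝ} (u : H1 κ) (f : Plane → ℂ) : Prop :=
  u.1.fst =ᵐ[diskMeasure] f

/-- The Bessel function of the first kind of integer order, by its power series
`∑ (-1)^m / (m! Γ(p + m + 1)) (t/2)^(2m+p)`. The terms in which `Γ` has a pole vanish, as they
should: Mathlib's `Gamma` is `0` there, and so is the inverse of `0`. -/
def besselJ (p : ℤ) (t : ℝ) : ℝ :=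
  ∑' m : ℕ, (-1) ^ m / (m.factorial * Real.Gamma (p + m + 1)) * (t / 2) ^ (2 * (m : ℤ) + p)

/-- The polar angle of a point of the plane. -/
def polarAngle (x : Plane) : ℝ := Complex.arg ⟨x 0, x 1⟩

/-- The circular wave `J_p(κ r) e^{i p θ}`. -/
def circularWave (κ : ℝ) (p : ℤ) (x : Plane) : ℂ :=
  besselJ p (κ * ‖x‖) * Complex.exp (Complex.I * p * polarAngle x)

/-- The space `ℬ` of Helmholtz solutions: the closure in `H¹` of the span of the circular waves
(normalizing the circular waves does not change the span). -/
def HelmholtzSpace (κ : ℝ) : Submodule ℂ (H1 κ) :=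
  (Submodule.span ℂ {u : H1 κ | ∃ p : ℤ, IsClassOf u (circularWave κ p)}).topologicalClosure

instance instCompleteSpaceHelmholtz (κ : ℝ) : CompleteSpace (HelmholtzSpace κ) :=
  (Submodule.isClosed_topologicalClosure _).completeSpace_coe

/-! ### The cylinder, the evanescent plane waves and the Herglotz densities -/

/-- The parametric domain `[0, 2π) × ℝ`, with points `(φ, ζ)`. -/
abbrev Cyl : Type := Ico (0 : ℝ) (2 * Real.pi) × ℝ

/-- Lebesgue measure on the cylinder. -/
def cylVolume : Measure Cyl :=
  ((volume : Measure ℝ).comap Subtype.val).prod (volume : Measure ℝ)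

/-- The evanescent plane wave `exp(i κ d(y) · x)` with
`d(y) = (cos (φ + i ζ), sin (φ + i ζ))`, for `y = (φ, ζ)`. -/
def evanescentWave (κ : ℝ) (y : Cyl) (x : Plane) : ℂ :=
  Complex.exp (Complex.I * κ *
    (Complex.cos ((y.1 : ℝ) + Complex.I * y.2) * x 0
      + Complex.sin ((y.1 : ℝ) + Complex.I * y.2) * x 1))

/-- The weight `w(y) = exp(-κ sinh |ζ| + |ζ|/4)`. -/
def weight (κ : ℝ) (y : Cyl) : ℝ := Real.exp (-κ * Real.sinh |y.2| + 1 / 4 * |y.2|)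

/-- The measure `w² dy` on the cylinder. -/
def cylMeasure (κ : ℝ) : Measure Cyl :=
  cylVolume.withDensity fun y => ENNReal.ofReal (weight κ y ^ 2)

/-- `ã_p(φ, ζ) = e^{pζ} e^{ipφ}`. -/
def aTilde (p : ℤ) (y : Cyl) : ℂ :=
  Complex.exp (p * y.2) * Complex.exp (Complex.I * p * (y.1 : ℝ))

/-- `α_p = ‖ã_p‖⁻¹`, the norm being that of `L²(w² dy)`. -/
def alpha (κ : ℝ) (p : ℤ) : ℝ := (Real.sqrt (∫ y, ‖aTilde p y‖ ^ 2 ∂cylMeasure κ))⁻¹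

/-- The Herglotz polynomial `a_p = α_p ã_p`. -/
def herglotzPoly (κ : ℝ) (p : ℤ) (y : Cyl) : ℂ := alpha κ p * aTilde p y

/-- The space `𝒜` of Herglotz densities: the closure in `L²(w² dy)` of the span of the `a_p`. -/
def HerglotzDensities (κ : ℝ) : Submodule ℂ (Lp ℂ 2 (cylMeasure κ)) :=
  (Submodule.span ℂ {v : Lp ℂ 2 (cylMeasure κ) |
    ∃ p : ℤ, v =ᵐ[cylMeasure κ] herglotzPoly κ p}).topologicalClosure

instance instCompleteSpaceHerglotz (κ : ℝ) : CompleteSpace (HerglotzDensities κ) :=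
  (Submodule.isClosed_topologicalClosure _).completeSpace_coe

/-- `T` is the Herglotz transform (synthesis operator):
`(T v)(x) = ∫ v(y) φ_y(x) w²(y) dy` on the disk, the integral being absolutely convergent at
every point `x` of the disk. -/
def IsHerglotzTransform {κ : ℝ} (T : HerglotzDensities κ →L[ℂ] HelmholtzSpace κ) : Prop :=
  ∀ v : HerglotzDensities κ,
    (∀ x ∈ Metric.ball (0 : Plane) 1,
      Integrable (fun y => v.1 y * evanescentWave κ y x) (cylMeasure κ)) ∧
    IsClassOf (T v).1 fun x => ∫ y, v.1 y * evanescentWave κ y x ∂cylMeasure κ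

/-- The analysis operator: the Hilbert space adjoint `T*`. -/
abbrev analysisOp {κ : ℝ} (T : HerglotzDensities κ →L[ℂ] HelmholtzSpace κ) :
    HelmholtzSpace κ →L[ℂ] HerglotzDensities κ :=
  ContinuousLinearMap.adjoint (𝕜 := ℂ) (E := HerglotzDensities κ) (F := HelmholtzSpace κ) T

end EvanescentWaves

end

open EvanescentWaves MeasureTheory

/-!
Write a point of the disk as `z = x₀ + i x₁` and put `b_p` for the circular wave of order `p`.
Multiplying the exponential series of `iκ/2 · z e^{-iω}` and `iκ/2 · z̄ e^{iω}` and collecting the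
terms by `p = m - n` gives the Jacobi–Anger expansion `φ_y = ∑ i^p conj(ã_p(y)) b_p`
(`hasSum_evanescentWave`). Integrating it against `e^{ipφ}` shows that the Herglotz transform maps
`ã_p` to `‖ã_p‖² i^p b_p` (`integral_aTilde_mul_evanescentWave`). The `ã_p` are orthogonal in
`L²(w² dy)` and the `b_p` in `H¹`, so in the orthonormal bases the transform is diagonal, with
factors of modulus `‖ã_p‖ ‖b_p‖`. Everything hinges on these being bounded above and below
(`exists_weightMoment_mul_circularEnergy_bounds`).

For `‖b_p‖`: the gradient of `b_p` is a combination of `b_{p-1}` and `b_{p+1}`, so that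
`‖b_p‖²` is a combination of three `L²` norms (`inner_circularH1`), and these follow the leading
term of the Bessel series; thus `‖b_p‖² ≍ (κ/2)^{2k} (k+1) / k!²` with `k = |p|`. For `‖ã_p‖`: the
substitution `s = κ e^ζ` turns the moments of the weight into Gamma integrals, so
`‖ã_p‖² ≍ κ^{-2k} Γ(2k + 1/2)`. The product is bounded above and below by `gamma_ratio_bounds`.

Hence the transform `T` is an isomorphism, as are `T*` and `S = T T*`. The vectors
`K_y = ∑ conj(a_p(y)) a_p` satisfy `T K_y = φ_y`, so evaluating `T* u` at `y` as `(u, φ_y)` amounts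
to pairing with `K_y`. On the basis this pairing returns `a_p(y)`, and by passing to almost
everywhere convergent subsequences it represents the class of every element
(`ae_eq_of_hilbertBasis`). The kernel formulas are Parseval's identity and `S⁻¹ = (T⁻¹)* T⁻¹`.
-/

noncomputable section

namespace EvanescentWaves

open MeasureTheory Set

open scoped ContDiff ComplexConjugate

/-! ### The Jacobi–Anger expansion -/

/-- The term of index `m` of the power series of `besselJ p t`. -/
def besselTerm (p : ℤ) (t : ℝ) (m : ℕ) : ℝ :=
  (-1) ^ m / (m.factorial * Real.Gamma (p + m + 1)) * (t / 2) ^ (2 * (m : ℤ) + p)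

theorem besselJ_eq_tsum (p : ℤ) (t : ℝ) : besselJ p t = ∑' m, besselTerm p t m := rfl

/-- Where `Γ` has a pole, the term of the Bessel series vanishes. -/
theorem besselTerm_eq_zero {p : ℤ} {m : ℕ} (h : p + m < 0) (t : ℝ) : besselTerm p t m = 0 := by
  obtain ⟨k, hk⟩ : ∃ k : ℕ, p + m + 1 = -(k : ℤ) := ⟨(-(p + m + 1)).toNat, by omega⟩
  have : (p + m + 1 : ℝ) = -(k : ℝ) := by exact_mod_cast hk
  simp [besselTerm, this, Real.Gamma_neg_nat_eq_zero]

/-- Only the orders `p = m - n` with natural `m` have a nonzero term of index `n`. For them the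
integer power in the definition is a natural one. -/
theorem besselTerm_sub (m n : ℕ) (t : ℝ) :
    besselTerm ((m : ℤ) - n) t n = (-1) ^ n / (n.factorial * m.factorial) * (t / 2) ^ (m + n) := by
  have h1 : (((m : ℤ) - n : ℤ) + n + 1 : ℝ) = m + 1 := by push_cast; ring
  have h2 : 2 * (n : ℤ) + (m - n) = ((m + n : ℕ) : ℤ) := by push_cast; ring
  rw [besselTerm, h1, h2, zpow_natCast, Real.Gamma_nat_eq_factorial]

/-- A point of the plane as a complex number in polar form. -/
theorem norm_mul_exp_polarAngle (x : Plane) :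
    (‖x‖ : ℂ) * Complex.exp (Complex.I * polarAngle x) = ⟨x 0, x 1⟩ := by
  have h : ‖x‖ = ‖(⟨x 0, x 1⟩ : ℂ)‖ := by
    rw [EuclideanSpace.norm_eq, Complex.norm_eq_sqrt_sq_add_sq]; simp
  rw [h, polarAngle, mul_comm Complex.I, Complex.norm_mul_exp_arg_mul_I]

/-- The general term of the double series for a plane wave is a term of a Bessel series. -/
theorem exp_term_mul_exp_term (κ : ℝ) (w : ℂ) (x : Plane) (m n : ℕ) :
    (Complex.I * κ / 2 * ⟨x 0, x 1⟩ * Complex.exp (-Complex.I * w)) ^ m / m.factorial *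
      ((Complex.I * κ / 2 * conj (⟨x 0, x 1⟩ : ℂ) * Complex.exp (Complex.I * w)) ^ n /
        n.factorial) =
    besselTerm ((m : ℤ) - n) (κ * ‖x‖) n *
      (Complex.exp (Complex.I * ((m : ℤ) - n : ℤ) * polarAngle x) *
        (Complex.I ^ ((m : ℤ) - n) * Complex.exp (-Complex.I * ((m : ℤ) - n : ℤ) * w))) := by
  have hI : Complex.I ^ ((m : ℤ) - n) = Complex.I ^ m * (-Complex.I) ^ n := by
    rw [zpow_sub₀ Complex.I_ne_zero, zpow_natCast, zpow_natCast, div_eq_mul_inv, ← inv_pow,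
      Complex.inv_I]
  have hexp (a b : ℂ) : Complex.exp (a * ((m : ℤ) - n : ℤ) * b) =
      Complex.exp (a * b) ^ m * Complex.exp (-(a * b)) ^ n := by
    rw [← Complex.exp_nat_mul, ← Complex.exp_nat_mul, ← Complex.exp_add]
    congr 1; push_cast; ring
  have hc : conj (⟨x 0, x 1⟩ : ℂ) = ‖x‖ * Complex.exp (-(Complex.I * polarAngle x)) := by
    rw [← norm_mul_exp_polarAngle, map_mul, Complex.conj_ofReal, ← Complex.exp_conj]
    simp
  have h1 : (Complex.I * κ / 2 * ‖x‖) ^ m * (Complex.I * κ / 2 * ‖x‖) ^ n =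
      Complex.I ^ m * (-Complex.I) ^ n * (-1) ^ n * (κ * ‖x‖ / 2) ^ (m + n) := by
    rw [mul_assoc (Complex.I ^ m), ← mul_pow (-Complex.I), neg_mul_neg, mul_one, ← pow_add,
      ← pow_add, ← mul_pow]
    congr 1; ring
  rw [besselTerm_sub, hI, hexp, hexp, hc, ← norm_mul_exp_polarAngle]
  push_cast
  have e1 : -(-Complex.I * w) = Complex.I * w := by ring
  rw [e1]
  generalize Complex.exp (Complex.I * polarAngle x) = P
  generalize Complex.exp (-(Complex.I * polarAngle x)) = Q
  generalize Complex.exp (Complex.I * w) = W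
  generalize Complex.exp (-Complex.I * w) = V
  calc _ = (Complex.I * κ / 2 * ‖x‖) ^ m * (Complex.I * κ / 2 * ‖x‖) ^ n *
        (P ^ m * Q ^ n * (V ^ m * W ^ n)) / (m.factorial * n.factorial) := by
        simp only [mul_pow]; ring
    _ = _ := by rw [h1]; ring

/-- The double series `∑ Z^m W^n / (m! n!)` of a plane wave, summed along `p = m - n`. -/
theorem hasSum_planeWave_double (κ : ℝ) (w : ℂ) (x : Plane) :
    HasSum (fun q : ℤ × ℕ => (besselTerm q.1 (κ * ‖x‖) q.2 : ℂ) *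
      (Complex.exp (Complex.I * q.1 * polarAngle x) *
        (Complex.I ^ q.1 * Complex.exp (-Complex.I * q.1 * w))))
      (Complex.exp (Complex.I * κ * (Complex.cos w * x 0 + Complex.sin w * x 1))) := by
  set Z : ℂ := Complex.I * κ / 2 * ⟨x 0, x 1⟩ * Complex.exp (-Complex.I * w) with hZ
  set W : ℂ := Complex.I * κ / 2 * conj (⟨x 0, x 1⟩ : ℂ) * Complex.exp (Complex.I * w) with hW
  have hZW : Complex.I * κ * (Complex.cos w * x 0 + Complex.sin w * x 1) = Z + W := by
    have hz : (⟨x 0, x 1⟩ : ℂ) = x 0 + x 1 * Complex.I := by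
      apply Complex.ext <;> simp
    rw [hZ, hW, hz, Complex.cos, Complex.sin, map_add, map_mul, Complex.conj_ofReal,
      Complex.conj_ofReal, Complex.conj_I, mul_comm w, neg_mul, mul_comm w]
    ring_nf
  have hexp (z : ℂ) : HasSum (fun n : ℕ => z ^ n / n.factorial) (Complex.exp z) := by
    rw [Complex.exp_eq_exp_ℂ]; exact NormedSpace.expSeries_div_hasSum_exp z
  have hnorm (z : ℂ) : Summable fun n : ℕ => ‖z ^ n / (n.factorial : ℂ)‖ :=
    NormedSpace.norm_expSeries_div_summable z
  have hdouble (Z W : ℂ) : HasSum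
      (fun q : ℕ × ℕ => Z ^ q.1 / q.1.factorial * (W ^ q.2 / q.2.factorial))
      (Complex.exp (Z + W)) := by
    have hs : Summable (fun q : ℕ × ℕ => Z ^ q.1 / q.1.factorial * (W ^ q.2 / q.2.factorial)) :=
      summable_mul_of_summable_norm (f := fun n : ℕ => Z ^ n / (n.factorial : ℂ))
        (g := fun n : ℕ => W ^ n / (n.factorial : ℂ)) (hnorm Z) (hnorm W)
    rw [Complex.exp_add]
    exact HasSum.mul (f := fun n : ℕ => Z ^ n / (n.factorial : ℂ))
        (g := fun n : ℕ => W ^ n / (n.factorial : ℂ)) (hexp Z) (hexp W) hs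
  have hinj : Function.Injective fun q : ℕ × ℕ => (((q.1 : ℤ) - q.2, q.2) : ℤ × ℕ) := by
    rintro ⟨a, b⟩ ⟨c, d⟩ h
    simp only [Prod.mk.injEq] at h ⊢
    omega
  rw [hZW]
  refine (hinj.hasSum_iff ?_).1 ?_
  · rintro ⟨p, n⟩ hpn
    have : p + n < 0 := by
      by_contra hcon
      exact hpn ⟨((p + n).toNat, n), by simp; omega⟩
    simp [besselTerm_eq_zero this]
  · refine (hdouble Z W).congr_fun fun q => ?_
    exact (exp_term_mul_exp_term κ w x q.1 q.2).symm

/-- The Jacobi–Anger expansion, for a possibly complex direction angle `w`. -/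
theorem hasSum_jacobiAnger (κ : ℝ) (w : ℂ) (x : Plane) :
    HasSum (fun p : ℤ => Complex.I ^ p * Complex.exp (-Complex.I * p * w) * circularWave κ p x)
      (Complex.exp (Complex.I * κ * (Complex.cos w * x 0 + Complex.sin w * x 1))) := by
  have h := hasSum_planeWave_double κ w x
  refine h.prod_fiberwise fun p => ?_
  have h2 := (h.summable.prod_factor p).hasSum
  have h3 : Complex.I ^ p * Complex.exp (-Complex.I * p * w) * circularWave κ p x =
      ∑' n : ℕ, (besselTerm p (κ * ‖x‖) n : ℂ) * (Complex.exp (Complex.I * p * polarAngle x) *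
        (Complex.I ^ p * Complex.exp (-Complex.I * p * w))) := by
    rw [tsum_mul_right, ← Complex.ofReal_tsum, ← besselJ_eq_tsum, circularWave]
    ring
  rw [h3]
  exact h2

theorem hasSum_evanescentWave (κ : ℝ) (y : Cyl) (x : Plane) :
    HasSum (fun p : ℤ => Complex.I ^ p * conj (aTilde p y) * circularWave κ p x)
      (evanescentWave κ y x) := by
  refine (hasSum_jacobiAnger κ ((y.1 : ℝ) + Complex.I * y.2) x).congr_fun fun p => ?_
  congr 2
  rw [aTilde, map_mul, ← Complex.exp_conj, ← Complex.exp_conj, ← Complex.exp_add]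
  congr 1
  simp
  ring_nf
  simp only [Complex.I_sq]; ring

/-- The terms of the Bessel series are summable: up to a nonzero factor they are a row of the
double series. -/
theorem summable_besselTerm (p : ℤ) {t : ℝ} (ht : 0 ≤ t) : Summable (besselTerm p t) := by
  have h := ((hasSum_planeWave_double 1 0 (EuclideanSpace.single 0 t)).summable.prod_factor p)
  have hne : (Complex.exp (Complex.I * p * polarAngle (EuclideanSpace.single 0 t)) *
        (Complex.I ^ p * Complex.exp (-Complex.I * p * 0))) ≠ 0 := by
    simp [Complex.exp_ne_zero, zpow_ne_zero]
  rw [summable_mul_right_iff hne] at h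
  simpa [abs_of_nonneg ht, Complex.summable_ofReal] using h

/-! ### Bounds for Bessel functions -/

theorem besselTerm_natCast (k m : ℕ) (t : ℝ) :
    besselTerm k t m = (-1) ^ m / (m.factorial * (m + k).factorial) * (t / 2) ^ (2 * m + k) := by
  have h := besselTerm_sub (m + k) m t
  have e : (((m + k : ℕ) : ℤ) - m) = k := by push_cast; ring
  rw [e] at h
  rw [h]; congr 2; ring

theorem abs_besselTerm_natCast_le (k m : ℕ) {t : ℝ} (ht : 0 ≤ t) :
    |besselTerm k t m| ≤
      (t / 2) ^ k / k.factorial * ((t ^ 2 / (4 * (k + 1))) ^ m / m.factorial) := by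
  have hf : ((k.factorial * (k + 1) ^ m : ℕ) : ℝ) ≤ ((m + k).factorial : ℕ) := by
    rw [add_comm m k]; exact_mod_cast Nat.factorial_mul_pow_le_factorial
  rw [besselTerm_natCast, abs_mul, abs_div, abs_pow, abs_neg, abs_one, one_pow,
    abs_of_nonneg (by positivity : (0 : ℝ) ≤ (t / 2) ^ (2 * m + k)),
    abs_of_nonneg (by positivity : (0 : ℝ) ≤ m.factorial * (m + k).factorial)]
  have e : (t / 2) ^ k / k.factorial * ((t ^ 2 / (4 * (k + 1))) ^ m / m.factorial) =
      1 / (m.factorial * (k.factorial * (k + 1) ^ m : ℕ)) * (t / 2) ^ (2 * m + k) := by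
    have : t ^ 2 / (4 * (k + 1)) = (t / 2) ^ 2 / (k + 1) := by field_simp; ring
    rw [this, div_pow ((t / 2) ^ 2), ← pow_mul, pow_add]
    push_cast
    field_simp
  rw [e]
  gcongr

theorem hasSum_exp_real (s : ℝ) : HasSum (fun n : ℕ => s ^ n / n.factorial) (Real.exp s) := by
  rw [Real.exp_eq_exp_ℝ]; exact NormedSpace.expSeries_div_hasSum_exp s

theorem abs_besselJ_natCast_le (k : ℕ) {t : ℝ} (ht : 0 ≤ t) :
    |besselJ k t| ≤ (t / 2) ^ k / k.factorial * Real.exp (t ^ 2 / (4 * (k + 1))) := by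
  rw [besselJ_eq_tsum]
  exact tsum_of_norm_bounded (f := besselTerm k t) ((hasSum_exp_real _).mul_left _)
    fun m => abs_besselTerm_natCast_le k m ht

/-- For small arguments the Bessel function is at least half of its leading term. -/
theorem half_leading_le_besselJ (k : ℕ) {t : ℝ} (ht : 0 ≤ t) (htk : t ^ 2 ≤ k + 1) :
    (t / 2) ^ k / k.factorial / 2 ≤ besselJ k t := by
  have h0 : besselTerm k t 0 = (t / 2) ^ k / k.factorial := by
    rw [besselTerm_natCast]; simp; ring
  have hs := summable_besselTerm k ht
  have hexp : HasSum (fun m : ℕ => (t / 2) ^ k / k.factorial *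
      ((t ^ 2 / (4 * (k + 1))) ^ (m + 1) / (m + 1).factorial))
      ((t / 2) ^ k / k.factorial * (Real.exp (t ^ 2 / (4 * (k + 1))) - 1)) := by
    refine HasSum.mul_left _ ?_
    have := (hasSum_nat_add_iff' 1).2 (hasSum_exp_real (t ^ 2 / (4 * (k + 1))))
    simpa using this
  have htail := tsum_of_norm_bounded (f := fun m => besselTerm k t (m + 1)) hexp
    fun m => abs_besselTerm_natCast_le k (m + 1) ht
  have hle : Real.exp (t ^ 2 / (4 * (k + 1))) - 1 ≤ 1 / 2 := by
    have h1 : t ^ 2 / (4 * (k + 1)) ≤ 1 / 4 := by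
      rw [div_le_iff₀ (by positivity)]; linarith
    have h2 := Real.add_one_le_exp (-(1 / 4) : ℝ)
    have h3 : Real.exp (1 / 4) * Real.exp (-(1 / 4)) = 1 := by rw [← Real.exp_add]; simp
    have h4 := Real.exp_le_exp.2 h1
    nlinarith [Real.exp_pos (1 / 4)]
  have hpos : 0 ≤ (t / 2) ^ k / (k.factorial : ℝ) := by positivity
  rw [besselJ_eq_tsum, hs.tsum_eq_zero_add, h0]
  have h5 := (abs_le.1 htail).1
  nlinarith [mul_le_mul_of_nonneg_left hle hpos]

theorem besselJ_neg_natCast (k : ℕ) {t : ℝ} (ht : 0 ≤ t) :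
    besselJ (-k) t = (-1) ^ k * besselJ k t := by
  have h1 (m : ℕ) : besselTerm (-k) t (m + k) = (-1) ^ k * besselTerm k t m := by
    have h := besselTerm_sub m (m + k) t
    have e : ((m : ℤ) - (m + k : ℕ)) = -k := by push_cast; ring
    rw [e] at h
    rw [h, besselTerm_natCast, pow_add]
    ring
  have h2 : ∑ m ∈ Finset.range k, besselTerm (-k) t m = 0 :=
    Finset.sum_eq_zero fun m hm =>
      besselTerm_eq_zero (by have := Finset.mem_range.1 hm; omega) t
  rw [besselJ_eq_tsum, ← (summable_besselTerm (-k) ht).sum_add_tsum_nat_add k, h2, zero_add]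
  simp_rw [h1]
  rw [tsum_mul_left, besselJ_eq_tsum]

theorem abs_besselJ_natAbs (p : ℤ) {t : ℝ} (ht : 0 ≤ t) :
    |besselJ p.natAbs t| = |besselJ p t| := by
  obtain h | h := Int.natAbs_eq p
  · rw [← h]
  · rw [h, besselJ_neg_natCast _ ht, abs_mul, abs_pow, abs_neg, abs_one, one_pow, one_mul]
    simp

theorem norm_circularWave {κ : ℝ} (hκ : 0 < κ) (p : ℤ) (x : Plane) :
    ‖circularWave κ p x‖ = |besselJ p.natAbs (κ * ‖x‖)| := by
  have h : Complex.I * p * polarAngle x = ((p * polarAngle x : ℝ) : ℂ) * Complex.I := by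
    push_cast; ring
  rw [circularWave, norm_mul, h, Complex.norm_exp_ofReal_mul_I, mul_one, Complex.norm_real,
    Real.norm_eq_abs, abs_besselJ_natAbs _ (by positivity)]

/-! ### Circular waves as superpositions of plane waves -/

theorem integral_exp_int_mul (n : ℤ) :
    ∫ φ in (0 : ℝ)..2 * Real.pi, Complex.exp (Complex.I * n * φ) =
      if n = 0 then 2 * (Real.pi : ℂ) else 0 := by
  split_ifs with h
  · simp [h]
  · have hc : Complex.I * (n : ℂ) ≠ 0 := mul_ne_zero Complex.I_ne_zero (by exact_mod_cast h)
    rw [integral_exp_mul_complex hc]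
    have : Complex.I * (n : ℂ) * ((2 * Real.pi : ℝ) : ℂ) = n * (2 * Real.pi * Complex.I) := by
      push_cast; ring
    rw [this, Complex.exp_int_mul_two_pi_mul_I]
    simp

/-- The circular waves are, up to constants, the Fourier coefficients in the angle `φ` of the
evanescent plane waves. -/
theorem integral_exp_mul_planeWave (κ ζ : ℝ) (p : ℤ) (x : Plane) :
    ∫ φ in (0 : ℝ)..2 * Real.pi, Complex.exp (Complex.I * p * φ) *
      Complex.exp (Complex.I * κ * (Complex.cos (φ + Complex.I * ζ) * x 0 +
        Complex.sin (φ + Complex.I * ζ) * x 1)) =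
      2 * Real.pi * (Complex.I ^ p * Complex.exp (p * ζ) * circularWave κ p x) := by
  set c : ℤ → ℂ := fun q => Complex.I ^ q * Complex.exp (q * ζ) * circularWave κ q x with hc
  have hterm (φ : ℝ) (q : ℤ) : Complex.exp (Complex.I * p * φ) * (Complex.I ^ q *
      Complex.exp (-Complex.I * q * (φ + Complex.I * ζ)) * circularWave κ q x) =
      Complex.exp (Complex.I * (p - q : ℤ) * φ) * c q := by
    have : Complex.I * p * φ + -Complex.I * q * (φ + Complex.I * ζ) =
        Complex.I * (p - q : ℤ) * φ + q * ζ := by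
      push_cast; ring_nf; simp only [Complex.I_sq]; ring
    calc _ = Complex.exp (Complex.I * p * φ + -Complex.I * q * (φ + Complex.I * ζ)) *
          (Complex.I ^ q * circularWave κ q x) := by rw [Complex.exp_add]; ring
      _ = _ := by rw [this, Complex.exp_add, hc]; ring
  have hsum (φ : ℝ) : HasSum (fun q : ℤ => Complex.exp (Complex.I * (p - q : ℤ) * φ) * c q)
      (Complex.exp (Complex.I * p * φ) *
      Complex.exp (Complex.I * κ * (Complex.cos (φ + Complex.I * ζ) * x 0 +
        Complex.sin (φ + Complex.I * ζ) * x 1))) := by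
    have := (hasSum_jacobiAnger κ (φ + Complex.I * ζ) x).mul_left (Complex.exp (Complex.I * p * φ))
    simpa only [hterm] using this
  have hnorm (φ : ℝ) (q : ℤ) : ‖Complex.exp (Complex.I * (p - q : ℤ) * φ) * c q‖ = ‖c q‖ := by
    have : Complex.I * (p - q : ℤ) * φ = (((p - q : ℤ) * φ : ℝ) : ℂ) * Complex.I := by
      push_cast; ring
    rw [norm_mul, this, Complex.norm_exp_ofReal_mul_I, one_mul]
  have hcs : Summable fun q => ‖c q‖ := by
    have := (hsum 0).summable.norm
    simpa only [hnorm] using this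
  have hint := intervalIntegral.hasSum_integral_of_dominated_convergence
    (μ := volume) (a := 0) (b := 2 * Real.pi)
    (F := fun (q : ℤ) (φ : ℝ) => Complex.exp (Complex.I * (p - q : ℤ) * φ) * c q)
    (fun q _ => ‖c q‖) (fun q => by
      apply Continuous.aestronglyMeasurable; fun_prop)
    (fun q => Filter.Eventually.of_forall fun φ _ => (hnorm φ q).le)
    (Filter.Eventually.of_forall fun φ _ => hcs)
    (by simp) (Filter.Eventually.of_forall fun φ _ => hsum φ)
  have hval (q : ℤ) : ∫ φ in (0 : ℝ)..2 * Real.pi, Complex.exp (Complex.I * (p - q : ℤ) * φ) * c q =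
      if q = p then 2 * Real.pi * c p else 0 := by
    rw [intervalIntegral.integral_mul_const, integral_exp_int_mul]
    by_cases h : q = p
    · simp [h]
    · rw [if_neg (by omega), if_neg h, zero_mul]
  simp only [hval] at hint
  exact hint.unique (hasSum_ite_eq p _)

/-- The circular wave as a superposition of propagative plane waves. -/
theorem integral_exp_mul_propagativeWave (κ : ℝ) (p : ℤ) (x : Plane) :
    ∫ φ in (0 : ℝ)..2 * Real.pi, Complex.exp (Complex.I * p * φ) *
      Complex.exp (Complex.I * κ * (Complex.cos φ * x 0 + Complex.sin φ * x 1)) =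
      2 * Real.pi * (Complex.I ^ p * circularWave κ p x) := by
  simpa using integral_exp_mul_planeWave κ 0 p x

theorem circularWave_eq_integral (κ : ℝ) (p : ℤ) (x : Plane) :
    circularWave κ p x = (2 * Real.pi * Complex.I ^ p)⁻¹ *
      ∫ φ in (0 : ℝ)..2 * Real.pi, Complex.exp (Complex.I * p * φ) *
        Complex.exp (Complex.I * κ * (Complex.cos φ * x 0 + Complex.sin φ * x 1)) := by
  have h : (2 * Real.pi * Complex.I ^ p : ℂ) ≠ 0 := by
    simp [Real.pi_ne_zero, zpow_ne_zero]
  rw [integral_exp_mul_propagativeWave, ← mul_assoc, ← mul_assoc, mul_assoc _ _ (Complex.I ^ p),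
    mul_assoc, inv_mul_cancel_left₀ h]

theorem norm_exp_mul_propagativeWave (κ φ : ℝ) (p : ℤ) (x : Plane) :
    ‖Complex.exp (Complex.I * p * φ) *
        Complex.exp (Complex.I * κ * (Complex.cos φ * x 0 + Complex.sin φ * x 1))‖ = 1 := by
  have : Complex.I * p * φ + Complex.I * κ * (Complex.cos φ * x 0 + Complex.sin φ * x 1) =
      ((p * φ + κ * (Real.cos φ * x 0 + Real.sin φ * x 1) : ℝ) : ℂ) * Complex.I := by
    push_cast; ring
  rw [← Complex.exp_add, this, Complex.norm_exp_ofReal_mul_I]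

theorem continuous_circularWave (κ : ℝ) (p : ℤ) : Continuous (circularWave κ p) := by
  have : circularWave κ p = fun x => _ := funext fun x => circularWave_eq_integral κ p x
  rw [this]
  refine continuous_const.mul
    (intervalIntegral.continuous_parametric_intervalIntegral_of_continuous' ?_ _ _)
  fun_prop

theorem norm_circularWave_le_one (κ : ℝ) (p : ℤ) (x : Plane) : ‖circularWave κ p x‖ ≤ 1 := by
  have h := intervalIntegral.norm_integral_le_of_norm_le_const (a := 0) (b := 2 * Real.pi)
    (fun φ _ => (norm_exp_mul_propagativeWave κ φ p x).le)
  rw [integral_exp_mul_propagativeWave] at h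
  have hpi := Real.pi_pos
  simp only [norm_mul, norm_zpow, Complex.norm_I, one_zpow, Complex.norm_real, sub_zero,
    Real.norm_eq_abs, one_mul, Complex.norm_ofNat, abs_of_pos hpi, abs_mul, abs_two] at h
  exact le_of_mul_le_mul_left (by linarith) (by positivity : 0 < 2 * Real.pi)

/-! ### Circular waves in the Sobolev space -/

/-- The gradient of the circular wave of order `p`, divided by `κ`. It is expressed through the
circular waves of the neighbouring orders. -/
def circularGrad (κ : ℝ) (p : ℤ) (x : Plane) : EuclideanSpace ℂ (Fin 2) :=
  !₂[(circularWave κ (p - 1) x - circularWave κ (p + 1) x) / 2,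
    Complex.I * (circularWave κ (p - 1) x + circularWave κ (p + 1) x) / 2]

theorem circularGrad_zero (κ : ℝ) (p : ℤ) (x : Plane) : circularGrad κ p x 0 =
    (circularWave κ (p - 1) x - circularWave κ (p + 1) x) / 2 := rfl

theorem circularGrad_one (κ : ℝ) (p : ℤ) (x : Plane) : circularGrad κ p x 1 =
    Complex.I * (circularWave κ (p - 1) x + circularWave κ (p + 1) x) / 2 := rfl

theorem continuous_circularGrad (κ : ℝ) (p : ℤ) : Continuous (circularGrad κ p) := by
  have h1 := continuous_circularWave κ (p - 1)
  have h2 := continuous_circularWave κ (p + 1)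
  refine (PiLp.continuous_toLp 2 _).comp (continuous_pi fun i => ?_)
  fin_cases i
  · exact (h1.sub h2).div_const 2
  · exact (continuous_const.mul (h1.add h2)).div_const 2

/-- Differentiation under the integral sign, in the representation of the circular wave as a
superposition of plane waves. -/
theorem hasLineDerivAt_circularWave (κ : ℝ) (p : ℤ) (x v : Plane) :
    HasLineDerivAt ℝ (circularWave κ p)
      (κ * (v 0 * circularGrad κ p x 0 + v 1 * circularGrad κ p x 1)) x v := by
  have hI : Complex.I ^ p ≠ 0 := zpow_ne_zero _ Complex.I_ne_zero
  have hpi : (Real.pi : ℂ) ≠ 0 := by exact_mod_cast Real.pi_ne_zero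
  set F : ℝ → ℝ → ℂ := fun s φ => Complex.exp (Complex.I * p * φ) *
    Complex.exp (Complex.I * κ *
      (Complex.cos φ * (x + s • v) 0 + Complex.sin φ * (x + s • v) 1)) with hF
  set F' : ℝ → ℝ → ℂ := fun s φ =>
    Complex.I * κ * (Complex.cos φ * v 0 + Complex.sin φ * v 1) * F s φ with hF'
  have hFc (s : ℝ) : Continuous (F s) := by rw [hF]; fun_prop
  have hF'c (s : ℝ) : Continuous (F' s) := by
    have := hFc s
    rw [hF']; fun_prop
  have hnorm (s φ : ℝ) : ‖F' s φ‖ ≤ |κ| * (|v 0| + |v 1|) := by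
    have h1 : ‖F s φ‖ = 1 := norm_exp_mul_propagativeWave κ φ p (x + s • v)
    have h2 : (Complex.cos φ * v 0 + Complex.sin φ * v 1) =
        ((Real.cos φ * v 0 + Real.sin φ * v 1 : ℝ) : ℂ) := by push_cast; ring
    rw [hF', norm_mul, h1, mul_one, h2, norm_mul, norm_mul, Complex.norm_I, one_mul,
      Complex.norm_real, Complex.norm_real, Real.norm_eq_abs, Real.norm_eq_abs]
    gcongr
    refine (abs_add_le _ _).trans ?_
    rw [abs_mul, abs_mul]
    gcongr
    · exact mul_le_of_le_one_left (abs_nonneg _) (Real.abs_cos_le_one φ)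
    · exact mul_le_of_le_one_left (abs_nonneg _) (Real.abs_sin_le_one φ)
  have hderiv (φ s : ℝ) : HasDerivAt (fun s => F s φ) (F' s φ) s := by
    have hr : HasDerivAt (fun s : ℝ => (s : ℂ)) 1 s := Complex.ofRealCLM.hasDerivAt
    have h1 : HasDerivAt (fun s : ℝ => Complex.I * κ *
        (Complex.cos φ * (x + s • v) 0 + Complex.sin φ * (x + s • v) 1))
        (Complex.I * κ * (Complex.cos φ * v 0 + Complex.sin φ * v 1)) s := by
      have e : (fun s : ℝ => Complex.I * κ *
          (Complex.cos φ * (x + s • v) 0 + Complex.sin φ * (x + s • v) 1)) =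
          fun s : ℝ => Complex.I * κ * (Complex.cos φ * x 0 + Complex.sin φ * x 1) +
            s * (Complex.I * κ * (Complex.cos φ * v 0 + Complex.sin φ * v 1)) := by
        funext s; simp; ring
      rw [e]
      simpa using (hr.mul_const
        (Complex.I * κ * (Complex.cos φ * v 0 + Complex.sin φ * v 1))).const_add
          (Complex.I * κ * (Complex.cos φ * x 0 + Complex.sin φ * x 1))
    have h2 := h1.cexp.const_mul (Complex.exp (Complex.I * p * φ))
    refine h2.congr_deriv ?_
    simp only [hF', hF]; ring
  have hmain := (intervalIntegral.hasDerivAt_integral_of_dominated_loc_of_deriv_le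
    (μ := volume) (a := 0) (b := 2 * Real.pi) (F := F) (F' := F') (x₀ := 0)
    (bound := fun _ => |κ| * (|v 0| + |v 1|)) Filter.univ_mem
    (Filter.Eventually.of_forall fun s => (hFc s).aestronglyMeasurable)
    ((hFc 0).intervalIntegrable _ _) (hF'c 0).aestronglyMeasurable
    (Filter.Eventually.of_forall fun φ _ s _ => hnorm s φ) (by simp)
    (Filter.Eventually.of_forall fun φ _ s _ => hderiv φ s)).2
  have hval : ∫ φ in (0 : ℝ)..2 * Real.pi, F' 0 φ = 2 * Real.pi * Complex.I ^ p *
      (κ * (v 0 * circularGrad κ p x 0 + v 1 * circularGrad κ p x 1)) := by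
    have e (φ : ℝ) : F' 0 φ = Complex.I * κ / 2 * (v 0 - Complex.I * v 1) *
        (Complex.exp (Complex.I * (p + 1 : ℤ) * φ) *
          Complex.exp (Complex.I * κ * (Complex.cos φ * x 0 + Complex.sin φ * x 1))) +
        Complex.I * κ / 2 * (v 0 + Complex.I * v 1) *
        (Complex.exp (Complex.I * (p - 1 : ℤ) * φ) *
          Complex.exp (Complex.I * κ * (Complex.cos φ * x 0 + Complex.sin φ * x 1))) := by
      have e1 : Complex.exp (Complex.I * (p + 1 : ℤ) * φ) =
          Complex.exp (Complex.I * p * φ) * Complex.exp (φ * Complex.I) := by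
        rw [← Complex.exp_add]; congr 1; push_cast; ring
      have e2 : Complex.exp (Complex.I * (p - 1 : ℤ) * φ) =
          Complex.exp (Complex.I * p * φ) * Complex.exp (-φ * Complex.I) := by
        rw [← Complex.exp_add]; congr 1; push_cast; ring
      have e3 : F 0 φ = Complex.exp (Complex.I * p * φ) *
          Complex.exp (Complex.I * κ * (Complex.cos φ * x 0 + Complex.sin φ * x 1)) := by
        simp [hF]
      have ec : Complex.cos φ * v 0 + Complex.sin φ * v 1 =
          (v 0 - Complex.I * v 1) / 2 * Complex.exp (φ * Complex.I) +
          (v 0 + Complex.I * v 1) / 2 * Complex.exp (-φ * Complex.I) := by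
        rw [Complex.cos, Complex.sin]; ring
      simp only [hF']
      rw [e3, ec, e1, e2]
      ring
    have hci (q : ℤ) : IntervalIntegrable (fun φ : ℝ => Complex.exp (Complex.I * q * φ) *
          Complex.exp (Complex.I * κ * (Complex.cos φ * x 0 + Complex.sin φ * x 1)))
        volume 0 (2 * Real.pi) := by
      apply Continuous.intervalIntegrable; fun_prop
    simp_rw [e]
    rw [intervalIntegral.integral_add ((hci _).const_mul _) ((hci _).const_mul _),
      intervalIntegral.integral_const_mul, intervalIntegral.integral_const_mul,
      integral_exp_mul_propagativeWave, integral_exp_mul_propagativeWave,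
      zpow_add₀ Complex.I_ne_zero, zpow_sub₀ Complex.I_ne_zero, zpow_one, Complex.div_I,
      circularGrad_zero, circularGrad_one]
    ring_nf
    simp only [Complex.I_sq, Complex.I_pow_three]
    ring
  have hfun : (fun s : ℝ => circularWave κ p (x + s • v)) = fun s =>
      (2 * Real.pi * Complex.I ^ p)⁻¹ * ∫ φ in (0 : ℝ)..2 * Real.pi, F s φ := by
    funext s; exact circularWave_eq_integral κ p (x + s • v)
  rw [HasLineDerivAt, hfun]
  refine (hmain.const_mul _).congr_deriv ?_
  rw [hval, inv_mul_cancel_left₀]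
  simp [hpi, hI]

instance isFiniteMeasure_diskMeasure : IsFiniteMeasure diskMeasure := by
  unfold diskMeasure
  exact isFiniteMeasure_restrict.2 measure_ball_lt_top.ne

theorem norm_circularGrad_le (κ : ℝ) (p : ℤ) (x : Plane) : ‖circularGrad κ p x‖ ≤ 2 := by
  have h1 := norm_circularWave_le_one κ (p - 1) x
  have h2 := norm_circularWave_le_one κ (p + 1) x
  have ha : ‖circularGrad κ p x 0‖ ≤ 1 := by
    rw [circularGrad_zero, norm_div, Complex.norm_ofNat]
    linarith [norm_sub_le (circularWave κ (p - 1) x) (circularWave κ (p + 1) x)]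
  have hb : ‖circularGrad κ p x 1‖ ≤ 1 := by
    rw [circularGrad_one, norm_div, Complex.norm_ofNat, norm_mul, Complex.norm_I]
    linarith [norm_add_le (circularWave κ (p - 1) x) (circularWave κ (p + 1) x)]
  rw [EuclideanSpace.norm_eq, Real.sqrt_le_left (by norm_num), Fin.sum_univ_two]
  nlinarith [norm_nonneg (circularGrad κ p x 0), norm_nonneg (circularGrad κ p x 1)]

theorem memLp_circularWave (κ : ℝ) (p : ℤ) : MemLp (circularWave κ p) 2 diskMeasure :=
  MemLp.of_bound (continuous_circularWave κ p).aestronglyMeasurable 1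
    (Filter.Eventually.of_forall fun x => norm_circularWave_le_one κ p x)

theorem memLp_circularGrad (κ : ℝ) (p : ℤ) : MemLp (circularGrad κ p) 2 diskMeasure :=
  MemLp.of_bound (continuous_circularGrad κ p).aestronglyMeasurable 2
    (Filter.Eventually.of_forall fun x => norm_circularGrad_le κ p x)

/-- A function supported in the open unit disk has the same integral over the plane. -/
theorem integral_diskMeasure_of_tsupport {ψ : Plane → ℝ} (hs : tsupport ψ ⊆ Metric.ball 0 1)
    {f : Plane → ℂ} (hf : ∀ x, x ∉ tsupport ψ → f x = 0) :
    ∫ x, f x ∂diskMeasure = ∫ x, f x :=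
  setIntegral_eq_integral_of_forall_compl_eq_zero fun x hx => hf x fun h => hx (hs h)

theorem hasWeakGradient_circularWave (κ : ℝ) (p : ℤ) :
    HasWeakGradient (circularWave κ p) fun x => (κ : ℂ) • circularGrad κ p x := by
  intro ψ hψ hc hs i
  set e : Plane := EuclideanSpace.single i 1 with he
  have hψ' : Continuous fun x => fderiv ℝ ψ x e :=
    (hψ.continuous_fderiv (by simp)).clm_apply continuous_const
  have hc' : HasCompactSupport fun x => fderiv ℝ ψ x e := hc.fderiv_apply (𝕜 := ℝ) e
  have hb := continuous_circularWave κ p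
  have hg : Continuous fun x => ((κ : ℂ) • circularGrad κ p x) i :=
    ((PiLp.continuous_apply 2 _ i).comp ((continuous_circularGrad κ p).const_smul (κ : ℂ)))
  have key := integral_bilinear_hasLineDerivAt_right_eq_neg_left_of_integrable
    (μ := (volume : Measure Plane)) (f := ψ) (f' := fun x => fderiv ℝ ψ x e)
    (g := circularWave κ p) (g' := fun x => ((κ : ℂ) • circularGrad κ p x) i) (v := e)
    (B := ContinuousLinearMap.lsmul ℝ ℝ)
    ((hψ'.smul hb).integrable_of_hasCompactSupport (hc'.smul_right))
    ((hψ.continuous.smul hg).integrable_of_hasCompactSupport (hc.smul_right))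
    ((hψ.continuous.smul hb).integrable_of_hasCompactSupport (hc.smul_right))
    (fun x _ => ((hψ.differentiable (by simp)) x).hasFDerivAt.hasLineDerivAt e)
    (fun x _ => by
      have h := hasLineDerivAt_circularWave κ p x e
      have hval : (κ * (e 0 * circularGrad κ p x 0 + e 1 * circularGrad κ p x 1) : ℂ) =
          ((κ : ℂ) • circularGrad κ p x) i := by
        fin_cases i <;> simp [he]
      rwa [hval] at h)
  simp only [ContinuousLinearMap.lsmul_apply, Complex.real_smul] at key
  rw [integral_diskMeasure_of_tsupport hs, integral_diskMeasure_of_tsupport hs, key, neg_neg]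
  · intro x hx
    rw [image_eq_zero_of_notMem_tsupport hx]; simp
  · intro x hx
    rw [show fderiv ℝ ψ x = 0 from image_eq_zero_of_notMem_tsupport
      fun h => hx (tsupport_fderiv_subset ℝ h)]
    simp

/-- Weak gradients are unique. -/
theorem hasWeakGradient_zero {g : DiskL2Vec} (h : HasWeakGradient 0 fun x => g x) : g = 0 := by
  have hi (i : Fin 2) : ∀ᵐ x ∂diskMeasure, g x i = 0 := by
    have hint : Integrable (fun x => g x i) diskMeasure :=
      (((EuclideanSpace.proj i : EuclideanSpace ℂ (Fin 2) →L[ℂ] ℂ).comp_memLp' (Lp.memLp g))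
        ).integrable (by norm_num)
    have := Metric.isOpen_ball.ae_eq_zero_of_integral_contDiff_smul_eq_zero
      (U := Metric.ball (0 : Plane) 1) (μ := diskMeasure) (f := fun x => g x i)
      (hint.locallyIntegrable.locallyIntegrableOn _) (fun ψ hψ hc hs => by
        have := h ψ hψ hc hs i
        simpa using this)
    filter_upwards [this, ae_restrict_mem Metric.isOpen_ball.measurableSet] with x hx hmem
    exact hx hmem
  refine Lp.ext ?_
  filter_upwards [ae_all_iff.2 hi, Lp.coeFn_zero (EuclideanSpace ℂ (Fin 2)) 2 diskMeasure]
    with x hx h0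
  rw [h0]
  ext i
  simpa using hx i

/-- An element of `H¹` is determined by the function that it is the class of. -/
theorem IsClassOf.unique {κ : ℝ} (hκ : 0 < κ) {u v : H1 κ} {f : Plane → ℂ}
    (hu : IsClassOf u f) (hv : IsClassOf v f) : u = v := by
  have h1 : (u - v).1.fst = 0 := by
    have : u.1.fst = v.1.fst := Lp.ext (hu.trans hv.symm)
    simp [this]
  have h2 : HasWeakGradient (u - v).1.fst fun x => (κ : ℂ) • (u - v).1.snd x := (u - v).2
  have h3 : (κ : ℂ) • (u - v).1.snd = 0 := by
    refine hasWeakGradient_zero fun ψ hψ hc hs i => ?_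
    have h4 := h2 ψ hψ hc hs i
    rw [h1] at h4
    have e1 : ∫ x, ((fderiv ℝ ψ x (EuclideanSpace.single i 1) : ℝ) : ℂ) *
        (0 : DiskL2) x ∂diskMeasure = 0 := by
      rw [← integral_zero Plane ℂ (μ := diskMeasure)]
      refine integral_congr_ae ?_
      filter_upwards [Lp.coeFn_zero ℂ 2 diskMeasure] with x hx
      rw [hx]; simp
    rw [e1] at h4
    have e2 : ∫ x, (ψ x : ℂ) * ((κ : ℂ) • (u - v).1.snd : DiskL2Vec) x i ∂diskMeasure =
        ∫ x, (ψ x : ℂ) * ((κ : ℂ) • (u - v).1.snd x) i ∂diskMeasure := by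
      refine integral_congr_ae ?_
      filter_upwards [Lp.coeFn_smul (κ : ℂ) (u - v).1.snd] with x hx
      rw [hx]; rfl
    rw [e2, ← h4]
    simp
  have h5 : (u - v).1.snd = 0 := by
    rcases smul_eq_zero.1 h3 with h | h
    · exact absurd (by exact_mod_cast h) hκ.ne'
    · exact h
  refine sub_eq_zero.1 (Subtype.ext (WithLp.ofLp_injective 2 (Prod.ext h1 h5)))

/-- The circular wave of order `p` as an element of `H¹`. -/
def circularH1 (κ : ℝ) (p : ℤ) : H1 κ :=
  ⟨WithLp.toLp 2 ((memLp_circularWave κ p).toLp _, (memLp_circularGrad κ p).toLp _), by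
    intro ψ hψ hc hs i
    have h := hasWeakGradient_circularWave κ p ψ hψ hc hs i
    refine Eq.trans (integral_congr_ae ?_) (h.trans (congrArg Neg.neg (integral_congr_ae ?_)))
    · filter_upwards [(memLp_circularWave κ p).coeFn_toLp] with x hx
      exact congrArg _ hx
    · filter_upwards [(memLp_circularGrad κ p).coeFn_toLp] with x hx
      exact congrArg (fun z : EuclideanSpace ℂ (Fin 2) => (ψ x : ℂ) * ((κ : ℂ) • z) i) hx.symm⟩

theorem isClassOf_circularH1 (κ : ℝ) (p : ℤ) :
    IsClassOf (circularH1 κ p) (circularWave κ p) :=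
  (memLp_circularWave κ p).coeFn_toLp

theorem helmholtzSpace_eq {κ : ℝ} (hκ : 0 < κ) :
    HelmholtzSpace κ = (Submodule.span ℂ (range (circularH1 κ))).topologicalClosure := by
  have : {u : H1 κ | ∃ p : ℤ, IsClassOf u (circularWave κ p)} = range (circularH1 κ) := by
    ext u
    constructor
    · rintro ⟨p, hp⟩
      exact ⟨p, (isClassOf_circularH1 κ p).unique hκ hp⟩
    · rintro ⟨p, rfl⟩
      exact ⟨p, isClassOf_circularH1 κ p⟩
  rw [HelmholtzSpace, this]

/-! ### Orthogonality of the circular waves -/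

/-- The rotation of the plane by the angle `t`. -/
def planeRotation (t : ℝ) : Plane ≃ₗᵢ[ℝ] Plane :=
  Complex.orthonormalBasisOneI.repr.symm.trans
    ((rotation (Circle.exp t)).trans Complex.orthonormalBasisOneI.repr)

theorem planeRotation_toComplex (t : ℝ) (x : Plane) :
    (⟨planeRotation t x 0, planeRotation t x 1⟩ : ℂ) =
      Complex.exp (t * Complex.I) * ⟨x 0, x 1⟩ := by
  have h (y : Plane) : (⟨y 0, y 1⟩ : ℂ) = Complex.orthonormalBasisOneI.repr.symm y := by
    rw [LinearIsometryEquiv.eq_symm_apply]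
    ext i
    fin_cases i <;> simp
  rw [h, h, planeRotation]
  simp [rotation_apply]

theorem circularWave_planeRotation (κ : ℝ) (p : ℤ) (t : ℝ) {x : Plane} (hx : x ≠ 0) :
    circularWave κ p (planeRotation t x) =
      Complex.exp (p * t * Complex.I) * circularWave κ p x := by
  have hn : ‖planeRotation t x‖ = ‖x‖ := (planeRotation t).norm_map x
  have hne : (‖x‖ : ℂ) ≠ 0 := by exact_mod_cast norm_ne_zero_iff.2 hx
  have h1 : Complex.exp (Complex.I * polarAngle (planeRotation t x)) =
      Complex.exp (t * Complex.I) * Complex.exp (Complex.I * polarAngle x) := by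
    have h := norm_mul_exp_polarAngle (planeRotation t x)
    rw [planeRotation_toComplex, ← norm_mul_exp_polarAngle, hn] at h
    exact mul_left_cancel₀ hne (h.trans (by ring))
  have h2 (a : ℂ) : Complex.exp (Complex.I * p * a) = Complex.exp (Complex.I * a) ^ p := by
    rw [← Complex.exp_int_mul]; congr 1; ring
  have h3 : Complex.exp (p * t * Complex.I) = Complex.exp (t * Complex.I) ^ p := by
    rw [← Complex.exp_int_mul]; congr 1; ring
  rw [circularWave, circularWave, hn, h2, h2, h3, h1, mul_zpow]
  ring

/-- Rotation invariance makes circular waves of different orders orthogonal. -/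
theorem integral_conj_circularWave_mul_of_ne (κ : ℝ) {p q : ℤ} (hpq : p ≠ q) :
    ∫ x, conj (circularWave κ p x) * circularWave κ q x ∂diskMeasure = 0 := by
  -- With this angle, the integrand changes its sign under the rotation.
  set t : ℝ := Real.pi / (q - p) with ht
  have hqp : (q - p : ℝ) ≠ 0 := by
    rw [sub_ne_zero]; exact_mod_cast hpq.symm
  have hpre : planeRotation t ⁻¹' Metric.ball 0 1 = Metric.ball 0 1 := by
    ext x; simp
  have hmp : MeasurePreserving (planeRotation t) diskMeasure diskMeasure := by
    have := (planeRotation t).measurePreserving.restrict_preimage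
      (Metric.isOpen_ball.measurableSet (s := Metric.ball (0 : Plane) 1))
    rwa [hpre] at this
  have hrot := hmp.integral_comp (planeRotation t).toHomeomorph.measurableEmbedding
    (fun x => conj (circularWave κ p x) * circularWave κ q x)
  have hne : ∀ᵐ x ∂diskMeasure, x ≠ 0 :=
    ae_restrict_of_ae (by simp [ae_iff, measure_singleton])
  have hneg : ∫ x, conj (circularWave κ p (planeRotation t x)) *
      circularWave κ q (planeRotation t x) ∂diskMeasure =
      - ∫ x, conj (circularWave κ p x) * circularWave κ q x ∂diskMeasure := by
    rw [← integral_neg]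
    refine integral_congr_ae ?_
    filter_upwards [hne] with x hx
    rw [circularWave_planeRotation κ p t hx, circularWave_planeRotation κ q t hx, map_mul,
      ← Complex.exp_conj]
    have : Complex.exp (conj (p * t * Complex.I)) * Complex.exp (q * t * Complex.I) = -1 := by
      rw [← Complex.exp_add, ← Complex.exp_pi_mul_I]
      congr 1
      have h2 : ((q - p : ℝ) : ℂ) * t = Real.pi := by
        rw [← Complex.ofReal_mul, ht, mul_div_cancel₀ _ hqp]
      rw [← h2]
      simp
      ring
    linear_combination (conj (circularWave κ p x) * circularWave κ q x) * this
  have := hneg.symm.trans hrot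
  exact self_eq_neg.1 this.symm

/-- The square of the `L²` norm of a circular wave on the disk. -/
def circularMass (κ : ℝ) (p : ℤ) : ℝ := ∫ x, ‖circularWave κ p x‖ ^ 2 ∂diskMeasure

theorem integral_conj_circularWave_mul (κ : ℝ) (p q : ℤ) :
    ∫ x, conj (circularWave κ p x) * circularWave κ q x ∂diskMeasure =
      if p = q then (circularMass κ p : ℂ) else 0 := by
  split_ifs with h
  · subst h
    rw [circularMass, ← integral_complex_ofReal]
    refine integral_congr_ae (Filter.Eventually.of_forall fun x => ?_)
    simp [Complex.conj_mul']
  · exact integral_conj_circularWave_mul_of_ne κ h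

theorem integrable_conj_circularWave_mul (κ : ℝ) (p q : ℤ) :
    Integrable (fun x => conj (circularWave κ p x) * circularWave κ q x) diskMeasure :=
  ((memLp_circularWave κ p).star).integrable_mul (memLp_circularWave κ q)

/-- The square of the `H¹` norm of a circular wave. -/
def circularEnergy (κ : ℝ) (p : ℤ) : ℝ :=
  circularMass κ p + (circularMass κ (p - 1) + circularMass κ (p + 1)) / 2

theorem inner_circularH1 (κ : ℝ) (p q : ℤ) :
    inner ℂ (circularH1 κ p) (circularH1 κ q) =
      if p = q then (circularEnergy κ p : ℂ) else 0 := by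
  have h1 : inner ℂ (circularH1 κ p).1.fst (circularH1 κ q).1.fst =
      ∫ x, conj (circularWave κ p x) * circularWave κ q x ∂diskMeasure := by
    rw [L2.inner_def]
    refine integral_congr_ae ?_
    filter_upwards [(memLp_circularWave κ p).coeFn_toLp, (memLp_circularWave κ q).coeFn_toLp]
      with x hp hq
    rw [RCLike.inner_apply, mul_comm]
    exact congrArg₂ (fun a b => conj a * b) hp hq
  have h2 : inner ℂ (circularH1 κ p).1.snd (circularH1 κ q).1.snd =
      ∫ x, (1 / 2 * (conj (circularWave κ (p - 1) x) * circularWave κ (q - 1) x) +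
        1 / 2 * (conj (circularWave κ (p + 1) x) * circularWave κ (q + 1) x)) ∂diskMeasure := by
    rw [L2.inner_def]
    refine integral_congr_ae ?_
    filter_upwards [(memLp_circularGrad κ p).coeFn_toLp, (memLp_circularGrad κ q).coeFn_toLp]
      with x hp hq
    have h3 : inner ℂ (circularGrad κ p x) (circularGrad κ q x) =
        1 / 2 * (conj (circularWave κ (p - 1) x) * circularWave κ (q - 1) x) +
        1 / 2 * (conj (circularWave κ (p + 1) x) * circularWave κ (q + 1) x) := by
      rw [PiLp.inner_apply, Fin.sum_univ_two, RCLike.inner_apply, RCLike.inner_apply,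
        circularGrad_zero, circularGrad_zero, circularGrad_one, circularGrad_one]
      simp only [map_div₀, map_sub, map_add, map_mul, Complex.conj_I, map_ofNat]
      ring_nf
      simp only [Complex.I_sq]
      ring
    rw [← h3]
    exact congrArg₂ (fun a b : EuclideanSpace ℂ (Fin 2) => inner ℂ a b) hp hq
  rw [Submodule.coe_inner, WithLp.prod_inner_apply]
  change inner ℂ (circularH1 κ p).1.fst (circularH1 κ q).1.fst +
    inner ℂ (circularH1 κ p).1.snd (circularH1 κ q).1.snd = _
  rw [h1, h2, integral_add ((integrable_conj_circularWave_mul κ _ _).const_mul _)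
    ((integrable_conj_circularWave_mul κ _ _).const_mul _), integral_const_mul,
    integral_const_mul, integral_conj_circularWave_mul, integral_conj_circularWave_mul,
    integral_conj_circularWave_mul]
  by_cases h : p = q
  · subst h
    simp [circularEnergy]; ring
  · simp [h]

/-! ### Size of the circular waves -/

theorem setIntegral_ball_norm_pow (k : ℕ) {δ : ℝ} (hδ : 0 ≤ δ) :
    ∫ x in Metric.ball (0 : Plane) δ, ‖x‖ ^ (2 * k) =
      volume.real (Metric.ball (0 : Plane) 1) * (δ ^ (2 * k + 2) / (k + 1)) := by
  have h1 : ∫ x in Metric.ball (0 : Plane) δ, ‖x‖ ^ (2 * k) =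
      ∫ x : Plane, (Iio δ).indicator (fun r : ℝ => r ^ (2 * k)) ‖x‖ := by
    rw [← integral_indicator Metric.isOpen_ball.measurableSet]
    congr 1
    funext x
    simp [indicator]
  have h2 : ∫ y in Ioi (0 : ℝ), y ^ (2 - 1) • (Iio δ).indicator (fun r : ℝ => r ^ (2 * k)) y =
      δ ^ (2 * k + 2) / (2 * k + 2) := by
    have e : (fun y : ℝ => y ^ (2 - 1) • (Iio δ).indicator (fun r : ℝ => r ^ (2 * k)) y) =
        (Iio δ).indicator fun r : ℝ => r ^ (2 * k + 1) := by
      funext y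
      by_cases hy : y ∈ Iio δ
      · simp [hy]; ring
      · simp [hy]
    rw [e, setIntegral_indicator measurableSet_Iio, Ioi_inter_Iio, ← integral_Ioc_eq_integral_Ioo,
      ← intervalIntegral.integral_of_le hδ, integral_pow]
    push_cast
    ring_nf
  rw [h1, integral_fun_norm_addHaar, finrank_euclideanSpace_fin, h2]
  simp only [nsmul_eq_mul, smul_eq_mul]
  push_cast
  field_simp

/-- The leading order of the `L²` mass of the circular waves of order `±k`. -/
def massScale (κ : ℝ) (k : ℕ) : ℝ := (κ / 2) ^ (2 * k) / ((k.factorial : ℝ) ^ 2 * (k + 1))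

/-- The leading order of the `H¹` energy of the circular waves of order `±k`. -/
def energyScale (κ : ℝ) (k : ℕ) : ℝ := (κ / 2) ^ (2 * k) * (k + 1) / (k.factorial : ℝ) ^ 2

theorem volume_real_ball_pos : 0 < volume.real (Metric.ball (0 : Plane) 1) :=
  ENNReal.toReal_pos (Metric.measure_ball_pos _ _ one_pos).ne' measure_ball_lt_top.ne

theorem integrable_norm_circularWave_sq (κ : ℝ) (p : ℤ) :
    Integrable (fun x => ‖circularWave κ p x‖ ^ 2) diskMeasure :=
  (memLp_circularWave κ p).integrable_norm_pow (by norm_num)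

theorem circularMass_le {κ : ℝ} (hκ : 0 < κ) (p : ℤ) :
    circularMass κ p ≤ Real.exp (κ ^ 2 / 4) ^ 2 * volume.real (Metric.ball (0 : Plane) 1) *
      massScale κ p.natAbs := by
  set k := p.natAbs with hk
  have hcont : Continuous fun x : Plane =>
      ((κ / 2) ^ k / k.factorial * Real.exp (κ ^ 2 / 4)) ^ 2 * ‖x‖ ^ (2 * k) := by fun_prop
  have hint : IntegrableOn (fun x : Plane =>
      ((κ / 2) ^ k / k.factorial * Real.exp (κ ^ 2 / 4)) ^ 2 * ‖x‖ ^ (2 * k))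
      (Metric.ball 0 1) :=
    (hcont.continuousOn.integrableOn_compact (isCompact_closedBall 0 1)).mono_set
      Metric.ball_subset_closedBall
  calc circularMass κ p ≤ ∫ x in Metric.ball (0 : Plane) 1,
        ((κ / 2) ^ k / k.factorial * Real.exp (κ ^ 2 / 4)) ^ 2 * ‖x‖ ^ (2 * k) := by
        refine setIntegral_mono_on (integrable_norm_circularWave_sq κ p) hint
          Metric.isOpen_ball.measurableSet fun x hx => ?_
        have hx1 : ‖x‖ < 1 := by simpa using hx
        have h1 := abs_besselJ_natCast_le k (by positivity : 0 ≤ κ * ‖x‖)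
        have h2 : (κ * ‖x‖) ^ 2 / (4 * (k + 1)) ≤ κ ^ 2 / 4 := by
          rw [mul_pow]
          calc _ ≤ κ ^ 2 * 1 / (4 * (0 + 1)) := by
                gcongr
                · exact pow_le_one₀ (norm_nonneg _) hx1.le
                · positivity
            _ = κ ^ 2 / 4 := by ring
        have h3 : |besselJ k (κ * ‖x‖)| ≤
            (κ / 2) ^ k / k.factorial * Real.exp (κ ^ 2 / 4) * ‖x‖ ^ k := by
          refine h1.trans ?_
          calc _ ≤ (κ * ‖x‖ / 2) ^ k / k.factorial * Real.exp (κ ^ 2 / 4) := by gcongr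
            _ = _ := by rw [show κ * ‖x‖ / 2 = κ / 2 * ‖x‖ by ring, mul_pow]; ring
        rw [norm_circularWave hκ, ← hk]
        calc _ ≤ ((κ / 2) ^ k / k.factorial * Real.exp (κ ^ 2 / 4) * ‖x‖ ^ k) ^ 2 := by gcongr
          _ = _ := by rw [mul_pow _ (‖x‖ ^ k), ← pow_mul, mul_comm k 2]
    _ = _ := by
        rw [integral_const_mul, setIntegral_ball_norm_pow k zero_le_one, massScale]
        field_simp
        ring

theorem le_circularMass {κ : ℝ} (hκ : 0 < κ) (p : ℤ) {δ : ℝ} (hδ : 0 ≤ δ) (hδ1 : δ ≤ 1)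
    (hδp : (κ * δ) ^ 2 ≤ p.natAbs + 1) :
    volume.real (Metric.ball (0 : Plane) 1) / 4 * δ ^ (2 * p.natAbs + 2) *
      massScale κ p.natAbs ≤ circularMass κ p := by
  set k := p.natAbs with hk
  have hcont : Continuous fun x : Plane =>
      ((κ / 2) ^ k / k.factorial / 2) ^ 2 * ‖x‖ ^ (2 * k) := by fun_prop
  have hint : IntegrableOn (fun x : Plane =>
      ((κ / 2) ^ k / k.factorial / 2) ^ 2 * ‖x‖ ^ (2 * k)) (Metric.ball 0 δ) :=
    (hcont.continuousOn.integrableOn_compact (isCompact_closedBall 0 δ)).mono_set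
      Metric.ball_subset_closedBall
  have hsub : Metric.ball (0 : Plane) δ ⊆ Metric.ball 0 1 := Metric.ball_subset_ball hδ1
  have hint2 : IntegrableOn (fun x => ‖circularWave κ p x‖ ^ 2) (Metric.ball 0 1) :=
    integrable_norm_circularWave_sq κ p
  calc _ = ∫ x in Metric.ball (0 : Plane) δ,
        ((κ / 2) ^ k / k.factorial / 2) ^ 2 * ‖x‖ ^ (2 * k) := by
        rw [integral_const_mul, setIntegral_ball_norm_pow k hδ, massScale]
        field_simp
        ring
    _ ≤ ∫ x in Metric.ball (0 : Plane) δ, ‖circularWave κ p x‖ ^ 2 := by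
        refine setIntegral_mono_on hint (hint2.mono_set hsub)
          Metric.isOpen_ball.measurableSet fun x hx => ?_
        have hx1 : ‖x‖ < δ := by simpa using hx
        have h0 : 0 ≤ κ * ‖x‖ := by positivity
        have h1 := half_leading_le_besselJ k h0
          (le_trans (pow_le_pow_left₀ h0 (by gcongr) 2) hδp)
        rw [norm_circularWave hκ, ← hk]
        calc _ = ((κ * ‖x‖ / 2) ^ k / k.factorial / 2) ^ 2 := by
              rw [show κ * ‖x‖ / 2 = κ / 2 * ‖x‖ by ring, mul_pow (κ / 2), mul_comm 2 k, pow_mul]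
              ring
          _ ≤ besselJ k (κ * ‖x‖) ^ 2 := by gcongr
          _ = _ := (sq_abs _).symm
    _ ≤ circularMass κ p :=
        setIntegral_mono_set hint2 (Filter.Eventually.of_forall fun x => by positivity)
          hsub.eventuallyLE

/-- Two-sided bound of the `L²` masses. For large orders the leading term of the Bessel function
dominates on the whole disk, for small ones at least on a disk of radius `1 / κ`. -/
theorem exists_circularMass_bounds {κ : ℝ} (hκ : 0 < κ) : ∃ c C : ℝ, 0 < c ∧ 0 < C ∧ ∀ p : ℤ,
    c * massScale κ p.natAbs ≤ circularMass κ p ∧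
      circularMass κ p ≤ C * massScale κ p.natAbs := by
  have hV := volume_real_ball_pos
  obtain ⟨n, hn⟩ := exists_nat_ge (κ ^ 2)
  set δ : ℝ := min 1 (1 / κ) with hδ
  have hδ0 : 0 < δ := by positivity
  have hδ1 : δ ≤ 1 := min_le_left _ _
  have hκδ : κ * δ ≤ 1 := by
    have : δ ≤ 1 / κ := min_le_right _ _
    rw [le_div_iff₀ hκ] at this; linarith
  refine ⟨volume.real (Metric.ball (0 : Plane) 1) / 4 * δ ^ (2 * n + 2), _, by positivity, ?_,
    fun p => ⟨?_, circularMass_le hκ p⟩⟩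
  · positivity
  have hs : 0 ≤ massScale κ p.natAbs := by unfold massScale; positivity
  by_cases h : n ≤ p.natAbs
  · have h1 : (n : ℝ) ≤ p.natAbs := by exact_mod_cast h
    refine le_trans ?_ (le_circularMass hκ p zero_le_one le_rfl (by rw [mul_one]; linarith))
    gcongr ?_ * ?_ * _
    rw [one_pow]
    exact pow_le_one₀ hδ0.le hδ1
  · refine le_trans ?_ (le_circularMass hκ p hδ0.le hδ1 ?_)
    · gcongr ?_ * ?_ * _
      exact pow_le_pow_of_le_one hδ0.le hδ1 (by omega)
    · have h0 : 0 ≤ κ * δ := by positivity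
      have h1 : (0 : ℝ) ≤ p.natAbs := by positivity
      nlinarith

theorem massScale_le_energyScale {κ : ℝ} (hκ : 0 < κ) (k : ℕ) :
    massScale κ k ≤ energyScale κ k := by
  rw [massScale, energyScale, div_mul_eq_div_div, div_le_iff₀ (by positivity), div_mul_eq_mul_div,
    mul_assoc]
  gcongr
  exact le_mul_of_one_le_right (by positivity) (by nlinarith [(Nat.cast_nonneg k : (0 : ℝ) ≤ k)])

theorem massScale_succ_le {κ : ℝ} (hκ : 0 < κ) (k : ℕ) :
    massScale κ (k + 1) ≤ κ ^ 2 / 4 * energyScale κ k := by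
  have h0 : (0 : ℝ) ≤ k := Nat.cast_nonneg k
  have e : massScale κ (k + 1) = κ ^ 2 / 4 * energyScale κ k / ((k + 1) ^ 3 * (k + 2)) := by
    rw [massScale, energyScale, Nat.factorial_succ]
    push_cast
    field_simp
    ring
  rw [e]
  refine div_le_self (by unfold energyScale; positivity) ?_
  have : 1 ≤ ((k : ℝ) + 1) ^ 3 := one_le_pow₀ (by linarith)
  nlinarith

theorem energyScale_succ (κ : ℝ) (k : ℕ) :
    energyScale κ (k + 1) = κ ^ 2 / 4 * ((k + 2) / (k + 1)) * massScale κ k := by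
  rw [massScale, energyScale, Nat.factorial_succ]
  push_cast
  field_simp
  ring

/-- Two-sided bound of the `H¹` energies. The dominant contribution comes from the neighbour of
smaller order in the gradient. -/
theorem exists_circularEnergy_bounds {κ : ℝ} (hκ : 0 < κ) : ∃ c C : ℝ, 0 < c ∧ 0 < C ∧ ∀ p : ℤ,
    c * energyScale κ p.natAbs ≤ circularEnergy κ p ∧
      circularEnergy κ p ≤ C * energyScale κ p.natAbs := by
  obtain ⟨c, C, hc, hC, hb⟩ := exists_circularMass_bounds hκ
  set s := κ ^ 2 / 4 with hs
  have hs0 : 0 < s := by positivity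
  have hm (k : ℕ) : 0 ≤ massScale κ k := by unfold massScale; positivity
  have he (k : ℕ) : 0 ≤ energyScale κ k := by unfold energyScale; positivity
  have hpos (p : ℤ) : 0 ≤ circularMass κ p := (mul_nonneg hc.le (hm _)).trans (hb p).1
  have hprev (k : ℕ) : massScale κ k ≤ 1 / s * energyScale κ (k + 1) := by
    have h1 : (1 : ℝ) ≤ (k + 2) / (k + 1) := by
      rw [le_div_iff₀ (by positivity)]; linarith
    have : 1 / s * energyScale κ (k + 1) = (k + 2) / (k + 1) * massScale κ k := by
      rw [energyScale_succ, ← hs]; field_simp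
    rw [this]
    exact le_mul_of_one_le_left (hm k) h1
  have hprev' (k : ℕ) : energyScale κ (k + 1) ≤ 2 * s * massScale κ k := by
    have h1 : ((k : ℝ) + 2) / (k + 1) ≤ 2 := by
      rw [div_le_iff₀ (by positivity)]
      linarith [(Nat.cast_nonneg k : (0 : ℝ) ≤ k)]
    rw [energyScale_succ, ← hs]
    calc _ ≤ s * 2 * massScale κ k := by gcongr; exact hm k
      _ = _ := by ring
  have hupper (p q : ℤ) (hq : q.natAbs ≤ p.natAbs + 1) (hq' : p.natAbs ≤ q.natAbs + 1) :
      circularMass κ q ≤ C * ((1 + s + 1 / s) * energyScale κ p.natAbs) := by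
    refine (hb q).2.trans (mul_le_mul_of_nonneg_left ?_ hC.le)
    have h1s : 0 ≤ 1 / s := by positivity
    have hE := he p.natAbs
    rcases (by omega : q.natAbs = p.natAbs ∨ q.natAbs = p.natAbs + 1 ∨
      p.natAbs = q.natAbs + 1) with h | h | h
    · rw [h]
      nlinarith [massScale_le_energyScale hκ p.natAbs, mul_nonneg hs0.le hE, mul_nonneg h1s hE]
    · rw [h]
      nlinarith [massScale_succ_le hκ p.natAbs, mul_nonneg h1s hE]
    · have := hprev q.natAbs
      rw [← h] at this
      nlinarith [mul_nonneg hs0.le hE]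
  refine ⟨min c (c / (4 * s)), 2 * (C * (1 + s + 1 / s)), by positivity, by positivity,
    fun p => ⟨?_, ?_⟩⟩
  · rw [circularEnergy]
    obtain h | ⟨j, hj⟩ : p.natAbs = 0 ∨ ∃ j, p.natAbs = j + 1 := by
      cases p.natAbs <;> simp
    · have h1 := (hb p).1
      have : energyScale κ p.natAbs = massScale κ p.natAbs := by
        rw [h]; simp [energyScale, massScale]
      rw [this]
      have h2 := mul_le_mul_of_nonneg_right (min_le_left c (c / (4 * s))) (hm p.natAbs)
      linarith [hpos (p - 1), hpos (p + 1)]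
    · have h1 : c * massScale κ j ≤ circularMass κ (p - 1) + circularMass κ (p + 1) := by
        rcases (by omega : (p - 1).natAbs = j ∨ (p + 1).natAbs = j) with h | h
        · have := (hb (p - 1)).1
          rw [h] at this; linarith [hpos (p + 1)]
        · have := (hb (p + 1)).1
          rw [h] at this; linarith [hpos (p - 1)]
      have h2 : min c (c / (4 * s)) * energyScale κ p.natAbs ≤ c * massScale κ j / 2 := by
        rw [hj]
        calc _ ≤ c / (4 * s) * (2 * s * massScale κ j) := by
              gcongr
              · exact he _
              · exact min_le_right _ _
              · exact hprev' j
          _ = _ := by field_simp; ring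
      linarith [hpos p]
  · have h1 := hupper p p (by omega) (by omega)
    have h2 := hupper p (p - 1) (by omega) (by omega)
    have h3 := hupper p (p + 1) (by omega) (by omega)
    rw [circularEnergy]
    linarith

/-! ### Moments of the weight -/

theorem exp_change_of_variables {s κ : ℝ} (x : ℝ) :
    |Real.exp x| • (Real.exp x ^ (s - 1) * Real.exp (-(κ * Real.exp x))) =
      Real.exp (s * x - κ * Real.exp x) := by
  rw [abs_of_pos (Real.exp_pos x), ← Real.exp_mul, smul_eq_mul, ← Real.exp_add, ← Real.exp_add]
  congr 1; ring

theorem integrable_exp_sub_exp {s κ : ℝ} (hs : 0 < s) (hκ : 0 < κ) :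
    Integrable fun x : ℝ => Real.exp (s * x - κ * Real.exp x) := by
  have h := (integrableOn_image_iff_integrableOn_abs_deriv_smul MeasurableSet.univ
    (fun x _ => (Real.hasDerivAt_exp x).hasDerivWithinAt) Real.exp_injective.injOn
    (fun t : ℝ => t ^ (s - 1) * Real.exp (-(κ * t)))).1
  rw [image_univ, Real.range_exp] at h
  simp only [exp_change_of_variables, integrableOn_univ] at h
  refine h ?_
  have := integrableOn_rpow_mul_exp_neg_mul_rpow (p := 1) (s := s - 1) (b := κ) (by linarith)
    one_pos hκ
  simpa using this

/-- The logarithmic form of Euler's integral for the Gamma function. -/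
theorem integral_exp_sub_exp {s κ : ℝ} (hs : 0 < s) (hκ : 0 < κ) :
    ∫ x : ℝ, Real.exp (s * x - κ * Real.exp x) = (1 / κ) ^ s * Real.Gamma s := by
  rw [← Real.integral_rpow_mul_exp_neg_mul_Ioi hs hκ]
  have h := integral_image_eq_integral_abs_deriv_smul MeasurableSet.univ
    (fun x _ => (Real.hasDerivAt_exp x).hasDerivWithinAt) Real.exp_injective.injOn
    (fun t : ℝ => t ^ (s - 1) * Real.exp (-(κ * t)))
  rw [image_univ, Real.range_exp] at h
  simp only [exp_change_of_variables, Measure.restrict_univ] at h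
  exact h.symm

/-- The squared weight as a function of the evanescence parameter `ζ`. -/
def weightSq (κ ζ : ℝ) : ℝ := Real.exp (-2 * κ * Real.sinh |ζ| + |ζ| / 2)

theorem weight_sq (κ : ℝ) (y : Cyl) : weight κ y ^ 2 = weightSq κ y.2 := by
  rw [weight, weightSq, ← Real.exp_nat_mul]
  congr 1; push_cast; ring

theorem continuous_weightSq (κ : ℝ) : Continuous (weightSq κ) := by
  unfold weightSq
  have := Real.continuous_sinh
  fun_prop

theorem weightSq_neg (κ ζ : ℝ) : weightSq κ (-ζ) = weightSq κ ζ := by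
  simp [weightSq]

/-- The exponential moments of the squared weight. -/
def weightMoment (κ s : ℝ) : ℝ := ∫ ζ : ℝ, Real.exp (s * ζ) * weightSq κ ζ

theorem weightMoment_neg (κ s : ℝ) : weightMoment κ (-s) = weightMoment κ s := by
  unfold weightMoment
  rw [← integral_neg_eq_self]
  simp [weightSq_neg]

theorem neg_two_mul_sinh (κ t : ℝ) :
    -2 * κ * Real.sinh t = -(κ * Real.exp t) + κ * Real.exp (-t) := by
  rw [Real.sinh_eq]; ring

theorem exp_mul_weightSq_le {κ : ℝ} (hκ : 0 < κ) (s ζ : ℝ) :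
    Real.exp (s * ζ) * weightSq κ ζ ≤
      Real.exp κ * (Real.exp ((|s| + 1 / 2) * ζ - κ * Real.exp ζ) +
        Real.exp ((|s| + 1 / 2) * (-ζ) - κ * Real.exp (-ζ))) := by
  have key : Real.exp (s * ζ) * weightSq κ ζ ≤
      Real.exp κ * Real.exp ((|s| + 1 / 2) * |ζ| - κ * Real.exp |ζ|) := by
    rw [weightSq, ← Real.exp_add, ← Real.exp_add, Real.exp_le_exp, neg_two_mul_sinh]
    have h1 : s * ζ ≤ |s| * |ζ| := (le_abs_self _).trans (abs_mul s ζ).le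
    have h2 : Real.exp (-|ζ|) ≤ 1 := Real.exp_le_one_iff.2 (by simp)
    nlinarith
  refine key.trans (mul_le_mul_of_nonneg_left ?_ (Real.exp_pos κ).le)
  rcases abs_choice ζ with h | h <;> rw [h]
  · linarith [Real.exp_pos ((|s| + 1 / 2) * (-ζ) - κ * Real.exp (-ζ))]
  · linarith [Real.exp_pos ((|s| + 1 / 2) * ζ - κ * Real.exp ζ)]

theorem integrable_exp_sub_exp_symm {s κ : ℝ} (hs : 0 < s) (hκ : 0 < κ) :
    Integrable fun x : ℝ => Real.exp κ * (Real.exp (s * x - κ * Real.exp x) +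
      Real.exp (s * (-x) - κ * Real.exp (-x))) :=
  ((integrable_exp_sub_exp hs hκ).add (integrable_exp_sub_exp hs hκ).comp_neg).const_mul _

theorem integrable_exp_mul_weightSq {κ : ℝ} (hκ : 0 < κ) (s : ℝ) :
    Integrable fun ζ : ℝ => Real.exp (s * ζ) * weightSq κ ζ := by
  have hc := continuous_weightSq κ
  refine (integrable_exp_sub_exp_symm (by positivity : 0 < |s| + 1 / 2) hκ).mono'
    (by fun_prop) (Filter.Eventually.of_forall fun ζ => ?_)
  rw [Real.norm_of_nonneg (by unfold weightSq; positivity)]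
  exact exp_mul_weightSq_le hκ s ζ

theorem weightMoment_le {κ : ℝ} (hκ : 0 < κ) {s : ℝ} (hs : 0 ≤ s) :
    weightMoment κ s ≤
      2 * Real.exp κ * ((1 / κ) ^ (s + 1 / 2) * Real.Gamma (s + 1 / 2)) := by
  have hs' : 0 < s + 1 / 2 := by positivity
  have h := integral_mono (integrable_exp_mul_weightSq hκ s)
    (integrable_exp_sub_exp_symm (by positivity : 0 < |s| + 1 / 2) hκ) (exp_mul_weightSq_le hκ s)
  rw [abs_of_nonneg hs] at h
  refine h.trans (le_of_eq ?_)
  rw [integral_const_mul, integral_add (integrable_exp_sub_exp hs' hκ)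
    (integrable_exp_sub_exp hs' hκ).comp_neg,
    integral_neg_eq_self (fun x : ℝ => Real.exp ((s + 1 / 2) * x - κ * Real.exp x)),
    integral_exp_sub_exp hs' hκ]
  ring

/-- The part of Euler's integral over `ζ > 0`, which increases with the exponent, controls the part
over `ζ ≤ 0`, which decreases. -/
theorem exists_le_weightMoment {κ : ℝ} (hκ : 0 < κ) : ∃ c : ℝ, 0 < c ∧ ∀ s : ℝ, 0 ≤ s →
    c * ((1 / κ) ^ (s + 1 / 2) * Real.Gamma (s + 1 / 2)) ≤ weightMoment κ s := by
  set f : ℝ → ℝ → ℝ := fun s x => Real.exp ((s + 1 / 2) * x - κ * Real.exp x) with hf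
  have hfi (s : ℝ) (hs : 0 ≤ s) : Integrable (f s) :=
    integrable_exp_sub_exp (by positivity) hκ
  set L : ℝ := ∫ x in Iic (0 : ℝ), f 0 x with hL
  set R : ℝ := ∫ x in Ioi (0 : ℝ), f 0 x with hR
  have hL0 : 0 ≤ L := integral_nonneg fun x => (Real.exp_pos _).le
  have hR0 : 0 < R := by
    have : NeZero (volume.restrict (Ioi (0 : ℝ))) := ⟨by simp⟩
    exact integral_exp_pos (hfi 0 le_rfl).integrableOn
  refine ⟨(L / R + 1)⁻¹, by positivity, fun s hs => ?_⟩
  rw [inv_mul_le_iff₀ (by positivity), ← integral_exp_sub_exp (by positivity : 0 < s + 1 / 2) hκ]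
  have h1 : ∫ x in Iic (0 : ℝ), f s x ≤ L :=
    setIntegral_mono_on (hfi s hs).integrableOn (hfi 0 le_rfl).integrableOn measurableSet_Iic
      fun x hx => Real.exp_le_exp.2 (by nlinarith [mul_nonneg hs (neg_nonneg.2 (mem_Iic.1 hx))])
  have h2 : R ≤ ∫ x in Ioi (0 : ℝ), f s x :=
    setIntegral_mono_on (hfi 0 le_rfl).integrableOn (hfi s hs).integrableOn measurableSet_Ioi
      fun x hx => Real.exp_le_exp.2 (by nlinarith [mul_nonneg hs (mem_Ioi.1 hx).le])
  have h3 : ∫ x in Ioi (0 : ℝ), f s x ≤ weightMoment κ s := by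
    refine (setIntegral_mono_on (hfi s hs).integrableOn
      (integrable_exp_mul_weightSq hκ s).integrableOn measurableSet_Ioi fun x hx => ?_).trans
      (setIntegral_le_integral (integrable_exp_mul_weightSq hκ s)
        (Filter.Eventually.of_forall fun ζ => by
          simp only [Pi.zero_apply, weightSq]; positivity))
    rw [hf, weightSq, abs_of_pos (mem_Ioi.1 hx), ← Real.exp_add, Real.exp_le_exp,
      neg_two_mul_sinh]
    linarith [mul_pos hκ (Real.exp_pos (-x))]
  have h4 := intervalIntegral.integral_Iic_add_Ioi (hfi s hs).integrableOn
    (hfi s hs).integrableOn (b := 0)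
  change ∫ x, f s x ≤ _
  rw [← h4]
  have h5 : L ≤ L / R * weightMoment κ s := by
    calc L = L / R * R := by field_simp
      _ ≤ _ := by gcongr; exact h2.trans h3
  linarith

/-- Stirling's formula up to constants. The ratio without the linear factor becomes a decreasing
sequence when multiplied by `n + 1`, and an increasing one when multiplied by `n + 1 / 8`. -/
theorem gamma_ratio_bounds (n : ℕ) :
    Real.Gamma (1 / 2) / 8 ≤
        Real.Gamma (2 * n + 1 / 2) * (n + 1) / (4 ^ n * (n.factorial : ℝ) ^ 2) ∧
      Real.Gamma (2 * n + 1 / 2) * (n + 1) / (4 ^ n * (n.factorial : ℝ) ^ 2) ≤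
        Real.Gamma (1 / 2) := by
  set r : ℕ → ℝ := fun n => Real.Gamma (2 * n + 1 / 2) / (4 ^ n * (n.factorial : ℝ) ^ 2) with hr
  have hr0 (n : ℕ) : 0 < r n := by
    have : 0 < Real.Gamma (2 * n + 1 / 2) := Real.Gamma_pos_of_pos (by positivity)
    positivity
  have hstep (n : ℕ) : r (n + 1) = r n * ((n + 3 / 4) * (n + 1 / 4) / (n + 1) ^ 2) := by
    have h1 : (2 * ((n + 1 : ℕ) : ℝ) + 1 / 2) = (2 * n + 1 / 2 + 1) + 1 := by push_cast; ring
    simp only [hr]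
    rw [h1, Real.Gamma_add_one (by positivity), Real.Gamma_add_one (by positivity),
      Nat.factorial_succ]
    push_cast
    field_simp
    ring
  have hlow : Real.Gamma (1 / 2) / 8 ≤ r n * (n + 1 / 8) := by
    induction n with
    | zero => simp [hr]; linarith
    | succ n ih =>
      refine ih.trans ?_
      rw [hstep, mul_assoc]
      refine mul_le_mul_of_nonneg_left ?_ (hr0 n).le
      push_cast
      rw [div_mul_eq_mul_div, le_div_iff₀ (by positivity)]
      nlinarith [(Nat.cast_nonneg n : (0 : ℝ) ≤ n)]
  have hup : r n * (n + 1) ≤ Real.Gamma (1 / 2) := by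
    clear hlow
    induction n with
    | zero => simp [hr]
    | succ n ih =>
      refine le_trans ?_ ih
      rw [hstep, mul_assoc]
      refine mul_le_mul_of_nonneg_left ?_ (hr0 n).le
      push_cast
      rw [div_mul_eq_mul_div, div_le_iff₀ (by positivity)]
      nlinarith [(Nat.cast_nonneg n : (0 : ℝ) ≤ n), sq_nonneg (n : ℝ)]
  have e : Real.Gamma (2 * n + 1 / 2) * (n + 1) / (4 ^ n * (n.factorial : ℝ) ^ 2) =
      r n * (n + 1) := by simp only [hr]; ring
  rw [e]
  exact ⟨hlow.trans (mul_le_mul_of_nonneg_left (by linarith) (hr0 n).le), hup⟩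

/-- The weight is tuned such that the masses of the Herglotz polynomials and the energies of the
circular waves are inverse to each other, up to constants. -/
theorem exists_weightMoment_mul_circularEnergy_bounds {κ : ℝ} (hκ : 0 < κ) :
    ∃ c C : ℝ, 0 < c ∧ 0 < C ∧ ∀ p : ℤ,
      c ≤ weightMoment κ (2 * p) * circularEnergy κ p ∧
        weightMoment κ (2 * p) * circularEnergy κ p ≤ C := by
  obtain ⟨c₁, h1, hlow⟩ := exists_le_weightMoment hκ
  obtain ⟨c₂, C₂, h2, h3, hE⟩ := exists_circularEnergy_bounds hκ
  have hG : 0 < Real.Gamma (1 / 2) := Real.Gamma_pos_of_pos (by norm_num)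
  set a : ℝ := (1 / κ) ^ (1 / 2 : ℝ) with ha
  have ha0 : 0 < a := by positivity
  have hprod (k : ℕ) : (1 / κ) ^ (2 * k + 1 / 2 : ℝ) * Real.Gamma (2 * k + 1 / 2) *
      energyScale κ k =
      a * (Real.Gamma (2 * k + 1 / 2) * (k + 1) / (4 ^ k * (k.factorial : ℝ) ^ 2)) := by
    have e1 : (1 / κ) ^ (2 * k + 1 / 2 : ℝ) = (1 / κ) ^ (2 * k) * a := by
      rw [Real.rpow_add (by positivity), ha, ← Real.rpow_natCast]; push_cast; rfl
    have e2 : (1 / κ) ^ (2 * k) * (κ / 2) ^ (2 * k) = 1 / 4 ^ k := by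
      rw [← mul_pow, show 1 / κ * (κ / 2) = 1 / 2 by field_simp, pow_mul, ← one_div_pow]
      norm_num
    rw [e1, energyScale]
    calc _ = (1 / κ) ^ (2 * k) * (κ / 2) ^ (2 * k) *
          (a * Real.Gamma (2 * k + 1 / 2) * ((k + 1) / (k.factorial : ℝ) ^ 2)) := by ring
      _ = _ := by rw [e2]; field_simp
  refine ⟨c₁ * c₂ * (a * (Real.Gamma (1 / 2) / 8)),
    2 * Real.exp κ * C₂ * (a * Real.Gamma (1 / 2)), by positivity, by positivity, fun p => ?_⟩
  set k := p.natAbs with hk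
  have hm : weightMoment κ (2 * p) = weightMoment κ (2 * k) := by
    rcases Int.natAbs_eq p with h | h <;> rw [← hk] at h
    · have : (p : ℝ) = k := by exact_mod_cast h
      rw [this]
    · have : (p : ℝ) = -(k : ℝ) := by exact_mod_cast h
      rw [← weightMoment_neg, this, mul_neg, neg_neg]
  have hes : 0 ≤ energyScale κ k := by unfold energyScale; positivity
  have hgk : 0 < Real.Gamma (2 * k + 1 / 2) := Real.Gamma_pos_of_pos (by positivity)
  have hl := hlow (2 * k) (by positivity)
  have hu := weightMoment_le hκ (s := 2 * k) (by positivity)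
  have hE' := hE p
  rw [← hk] at hE'
  have hr := gamma_ratio_bounds k
  rw [hm]
  constructor
  · calc _ ≤ c₁ * c₂ * (a * (Real.Gamma (2 * k + 1 / 2) * (k + 1) /
          (4 ^ k * (k.factorial : ℝ) ^ 2))) := by
          gcongr ?_ * (_ * ?_)
          exact hr.1
      _ = c₁ * ((1 / κ) ^ (2 * k + 1 / 2 : ℝ) * Real.Gamma (2 * k + 1 / 2)) *
          (c₂ * energyScale κ k) := by rw [← hprod]; ring
      _ ≤ _ := mul_le_mul hl hE'.1 (by positivity) ((by positivity : (0 : ℝ) ≤ _).trans hl)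
  · calc _ ≤ 2 * Real.exp κ * ((1 / κ) ^ (2 * k + 1 / 2 : ℝ) * Real.Gamma (2 * k + 1 / 2)) *
          (C₂ * energyScale κ k) :=
          mul_le_mul hu hE'.2 ((by positivity : (0 : ℝ) ≤ c₂ * energyScale κ k).trans hE'.1)
            (by positivity)
      _ = 2 * Real.exp κ * C₂ * (a * (Real.Gamma (2 * k + 1 / 2) * (k + 1) /
          (4 ^ k * (k.factorial : ℝ) ^ 2))) := by rw [← hprod]; ring
      _ ≤ _ := by
          gcongr ?_ * (_ * ?_)
          exact hr.2

/-! ### Integration over the cylinder -/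

/-- Lebesgue measure on the circle of angles `[0, 2π)`. -/
abbrev angleMeasure : Measure (Ico (0 : ℝ) (2 * Real.pi)) :=
  (volume : Measure ℝ).comap Subtype.val

instance isFiniteMeasure_angleMeasure : IsFiniteMeasure angleMeasure := by
  refine ⟨?_⟩
  rw [(MeasurableEmbedding.subtype_coe measurableSet_Ico).comap_apply, image_univ,
    Subtype.range_coe]
  exact measure_Ico_lt_top

theorem integral_angleMeasure (f : ℝ → ℂ) :
    ∫ φ, f φ ∂angleMeasure = ∫ φ in (0 : ℝ)..2 * Real.pi, f φ := by
  rw [integral_subtype_comap measurableSet_Ico, integral_Ico_eq_integral_Ioc,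
    intervalIntegral.integral_of_le (by positivity)]

theorem measurable_weight (κ : ℝ) : Measurable fun y : Cyl => ENNReal.ofReal (weight κ y ^ 2) := by
  simp_rw [weight_sq]
  have := continuous_weightSq κ
  fun_prop

theorem integral_cylMeasure {E : Type*} [NormedAddCommGroup E] [NormedSpace ℝ E] (κ : ℝ)
    (f : Cyl → E) :
    ∫ y, f y ∂cylMeasure κ = ∫ y, weightSq κ y.2 • f y ∂(angleMeasure.prod volume) := by
  rw [cylMeasure, integral_withDensity_eq_integral_toReal_smul (measurable_weight κ) (by simp)]
  simp_rw [ENNReal.toReal_ofReal (sq_nonneg _), weight_sq]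
  rfl

theorem integrable_cylMeasure_iff {E : Type*} [NormedAddCommGroup E] [NormedSpace ℝ E] (κ : ℝ)
    (f : Cyl → E) :
    Integrable f (cylMeasure κ) ↔
      Integrable (fun y => weightSq κ y.2 • f y) (angleMeasure.prod volume) := by
  rw [cylMeasure, integrable_withDensity_iff_integrable_smul' (measurable_weight κ) (by simp)]
  simp_rw [ENNReal.toReal_ofReal (sq_nonneg _), weight_sq]
  rfl

/-! ### The Herglotz polynomials -/

theorem continuous_aTilde (p : ℤ) : Continuous (aTilde p) := by
  unfold aTilde; fun_prop

theorem norm_aTilde_sq (p : ℤ) (y : Cyl) : ‖aTilde p y‖ ^ 2 = Real.exp (2 * p * y.2) := by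
  have h1 : (p : ℂ) * y.2 = ((p * y.2 : ℝ) : ℂ) := by push_cast; ring
  have h2 : Complex.I * p * (y.1 : ℝ) = ((p * y.1 : ℝ) : ℂ) * Complex.I := by push_cast; ring
  rw [aTilde, norm_mul, h1, h2, Complex.norm_exp_ofReal_mul_I, mul_one, Complex.norm_exp_ofReal,
    ← Real.exp_nat_mul]
  congr 1; push_cast; ring

theorem memLp_aTilde {κ : ℝ} (hκ : 0 < κ) (p : ℤ) : MemLp (aTilde p) 2 (cylMeasure κ) := by
  rw [memLp_two_iff_integrable_sq_norm (continuous_aTilde p).aestronglyMeasurable,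
    integrable_cylMeasure_iff]
  simp_rw [norm_aTilde_sq, smul_eq_mul, mul_comm (weightSq κ _)]
  have := (integrable_const (1 : ℝ) (μ := angleMeasure)).mul_prod
    (integrable_exp_mul_weightSq hκ (2 * p))
  simpa using this

theorem integral_conj_aTilde_mul {κ : ℝ} (p q : ℤ) :
    ∫ y, conj (aTilde p y) * aTilde q y ∂cylMeasure κ =
      if p = q then ((2 * Real.pi * weightMoment κ (2 * p) : ℝ) : ℂ) else 0 := by
  have h (y : Cyl) : weightSq κ y.2 • (conj (aTilde p y) * aTilde q y) =
      Complex.exp (Complex.I * (q - p : ℤ) * (y.1 : ℝ)) *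
        ((Real.exp ((p + q : ℤ) * y.2) * weightSq κ y.2 : ℝ) : ℂ) := by
    have e1 : conj (aTilde p y) * aTilde q y = Complex.exp (Complex.I * (q - p : ℤ) * (y.1 : ℝ)) *
        Complex.exp ((p + q : ℤ) * y.2) := by
      rw [aTilde, aTilde, map_mul, ← Complex.exp_conj, ← Complex.exp_conj, ← Complex.exp_add,
        ← Complex.exp_add, ← Complex.exp_add, ← Complex.exp_add]
      congr 1
      simp
      ring
    rw [e1, Complex.real_smul]
    push_cast
    ring
  rw [integral_cylMeasure]
  simp_rw [h]
  rw [integral_prod_mul (μ := angleMeasure) (ν := (volume : Measure ℝ))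
    (fun φ : Ico (0 : ℝ) (2 * Real.pi) => Complex.exp (Complex.I * (q - p : ℤ) * (φ : ℝ)))
    (fun ζ : ℝ => ((Real.exp ((p + q : ℤ) * ζ) * weightSq κ ζ : ℝ) : ℂ)),
    integral_angleMeasure (fun φ => Complex.exp (Complex.I * (q - p : ℤ) * φ)),
    integral_exp_int_mul]
  by_cases hpq : p = q
  · subst hpq
    rw [if_pos (by ring), if_pos rfl, integral_complex_ofReal, weightMoment]
    push_cast
    rw [two_mul (p : ℝ)]
  · rw [if_neg (by omega), if_neg hpq, zero_mul]

theorem integral_norm_aTilde_sq (κ : ℝ) (p : ℤ) :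
    ∫ y, ‖aTilde p y‖ ^ 2 ∂cylMeasure κ = 2 * Real.pi * weightMoment κ (2 * p) := by
  have h := integral_conj_aTilde_mul (κ := κ) p p
  simp_rw [Complex.conj_mul', if_pos] at h
  have h2 : ∫ y, ((‖aTilde p y‖ ^ 2 : ℝ) : ℂ) ∂cylMeasure κ =
      ((2 * Real.pi * weightMoment κ (2 * p) : ℝ) : ℂ) := by
    rw [← h]; push_cast; rfl
  rw [integral_complex_ofReal] at h2
  exact_mod_cast h2

theorem weightMoment_pos {κ : ℝ} (hκ : 0 < κ) (s : ℝ) : 0 < weightMoment κ s := by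
  have h := integrable_exp_mul_weightSq hκ s
  simp only [weightSq, ← Real.exp_add] at h
  have := integral_exp_pos h
  simpa only [weightMoment, weightSq, ← Real.exp_add] using this

theorem alpha_sq {κ : ℝ} (hκ : 0 < κ) (p : ℤ) :
    alpha κ p ^ 2 = (2 * Real.pi * weightMoment κ (2 * p))⁻¹ := by
  have := weightMoment_pos hκ (2 * p)
  rw [alpha, integral_norm_aTilde_sq, inv_pow, Real.sq_sqrt (by positivity)]

theorem alpha_pos {κ : ℝ} (hκ : 0 < κ) (p : ℤ) : 0 < alpha κ p := by
  have := weightMoment_pos hκ (2 * p)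
  rw [alpha, integral_norm_aTilde_sq]
  positivity

theorem memLp_herglotzPoly {κ : ℝ} (hκ : 0 < κ) (p : ℤ) :
    MemLp (herglotzPoly κ p) 2 (cylMeasure κ) :=
  (memLp_aTilde hκ p).const_mul _

/-- The class of the Herglotz polynomial `a_p` in `L²(w² dy)`. -/
def herglotzLp {κ : ℝ} (hκ : 0 < κ) (p : ℤ) : Lp ℂ 2 (cylMeasure κ) :=
  (memLp_herglotzPoly hκ p).toLp _

theorem herglotzDensities_eq {κ : ℝ} (hκ : 0 < κ) :
    HerglotzDensities κ =
      (Submodule.span ℂ (range (herglotzLp hκ))).topologicalClosure := by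
  have : {v : Lp ℂ 2 (cylMeasure κ) | ∃ p : ℤ, v =ᵐ[cylMeasure κ] herglotzPoly κ p} =
      range (herglotzLp hκ) := by
    ext v
    constructor
    · rintro ⟨p, hp⟩
      exact ⟨p, Lp.ext ((memLp_herglotzPoly hκ p).coeFn_toLp.trans hp.symm)⟩
    · rintro ⟨p, rfl⟩
      exact ⟨p, (memLp_herglotzPoly hκ p).coeFn_toLp⟩
  rw [HerglotzDensities, this]

theorem orthonormal_herglotzLp {κ : ℝ} (hκ : 0 < κ) : Orthonormal ℂ (herglotzLp hκ) := by
  rw [orthonormal_iff_ite]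
  intro p q
  have h : inner ℂ (herglotzLp hκ p) (herglotzLp hκ q) =
      ∫ y, (alpha κ p * alpha κ q : ℂ) * (conj (aTilde p y) * aTilde q y) ∂cylMeasure κ := by
    rw [L2.inner_def]
    refine integral_congr_ae ?_
    filter_upwards [(memLp_herglotzPoly hκ p).coeFn_toLp, (memLp_herglotzPoly hκ q).coeFn_toLp]
      with y hp hq
    rw [herglotzLp, herglotzLp, hp, hq, RCLike.inner_apply, herglotzPoly, herglotzPoly, map_mul,
      Complex.conj_ofReal]
    ring
  rw [h, integral_const_mul, integral_conj_aTilde_mul]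
  split_ifs with hpq
  · subst hpq
    have h1 := alpha_sq hκ p
    have h2 := weightMoment_pos hκ (2 * p)
    rw [← pow_two, ← Complex.ofReal_pow, ← Complex.ofReal_mul, h1, inv_mul_cancel₀ (by positivity)]
    simp
  · simp

/-! ### Plane waves as functions of the parameter -/

theorem norm_evanescentWave_le {κ : ℝ} (hκ : 0 < κ) (y : Cyl) (x : Plane) :
    ‖evanescentWave κ y x‖ ≤ Real.exp (κ * ‖x‖ * Real.sinh |y.2|) := by
  set φ : ℝ := y.1.1
  set ζ : ℝ := y.2
  have hre : (Complex.I * κ * (Complex.cos (φ + Complex.I * ζ) * x 0 +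
      Complex.sin (φ + Complex.I * ζ) * x 1)).re =
      κ * (Real.sinh ζ * (Real.sin φ * x 0 - Real.cos φ * x 1)) := by
    have hc : Complex.cos (φ + Complex.I * ζ) = ((Real.cos φ * Real.cosh ζ : ℝ) : ℂ) -
        ((Real.sin φ * Real.sinh ζ : ℝ) : ℂ) * Complex.I := by
      rw [mul_comm Complex.I, Complex.cos_add_mul_I]; push_cast; ring
    have hs : Complex.sin (φ + Complex.I * ζ) = ((Real.sin φ * Real.cosh ζ : ℝ) : ℂ) +
        ((Real.cos φ * Real.sinh ζ : ℝ) : ℂ) * Complex.I := by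
      rw [mul_comm Complex.I, Complex.sin_add_mul_I]; push_cast; ring
    have : Complex.I * κ * (Complex.cos (φ + Complex.I * ζ) * x 0 +
        Complex.sin (φ + Complex.I * ζ) * x 1) =
        ((κ * (Real.sinh ζ * (Real.sin φ * x 0 - Real.cos φ * x 1)) : ℝ) : ℂ) +
        ((κ * (Real.cosh ζ * (Real.cos φ * x 0 + Real.sin φ * x 1)) : ℝ) : ℂ) * Complex.I := by
      rw [hc, hs]; push_cast; ring_nf; simp only [Complex.I_sq]; ring
    rw [this, Complex.add_re, Complex.ofReal_re, Complex.re_ofReal_mul, Complex.I_re, mul_zero,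
      add_zero]
  rw [evanescentWave, Complex.norm_exp, hre, Real.exp_le_exp, mul_assoc]
  refine mul_le_mul_of_nonneg_left ?_ hκ.le
  have h1 : |Real.sin φ * x 0 - Real.cos φ * x 1| ≤ ‖x‖ := by
    rw [EuclideanSpace.norm_eq, Fin.sum_univ_two]
    refine Real.abs_le_sqrt ?_
    simp only [Real.norm_eq_abs, sq_abs]
    nlinarith [Real.sin_sq_add_cos_sq φ, sq_nonneg (Real.cos φ * x 0 + Real.sin φ * x 1)]
  calc _ ≤ |Real.sinh ζ * (Real.sin φ * x 0 - Real.cos φ * x 1)| := le_abs_self _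
    _ = Real.sinh |ζ| * |Real.sin φ * x 0 - Real.cos φ * x 1| := by rw [abs_mul, Real.abs_sinh]
    _ ≤ Real.sinh |ζ| * ‖x‖ := by
        gcongr
    _ = _ := mul_comm _ _

theorem continuous_evanescentWave (κ : ℝ) (x : Plane) :
    Continuous fun y : Cyl => evanescentWave κ y x := by
  unfold evanescentWave; fun_prop

/-- Inside the disk the weight dominates the growth of the plane waves in the parameter. -/
theorem memLp_evanescentWave {κ : ℝ} (hκ : 0 < κ) {x : Plane} (hx : x ∈ Metric.ball (0 : Plane) 1) :
    MemLp (fun y : Cyl => evanescentWave κ y x) 2 (cylMeasure κ) := by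
  have hx1 : ‖x‖ < 1 := by simpa using hx
  have hc := continuous_evanescentWave κ x
  rw [memLp_two_iff_integrable_sq_norm hc.aestronglyMeasurable, integrable_cylMeasure_iff]
  have hκ' : 0 < κ * (1 - ‖x‖) := mul_pos hκ (by linarith)
  have h := (integrable_const (1 : ℝ) (μ := angleMeasure)).mul_prod
    (integrable_exp_mul_weightSq hκ' 0)
  have hw := continuous_weightSq κ
  refine h.mono' (by fun_prop) (Filter.Eventually.of_forall fun y => ?_)
  rw [smul_eq_mul, Real.norm_of_nonneg (by unfold weightSq; positivity)]
  have h1 := pow_le_pow_left₀ (norm_nonneg _) (norm_evanescentWave_le hκ y x) 2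
  refine (mul_le_mul_of_nonneg_left h1 (by unfold weightSq; positivity)).trans (le_of_eq ?_)
  simp only [weightSq, ← Real.exp_nat_mul, ← Real.exp_add, one_mul]
  congr 1; push_cast; ring

theorem integral_aTilde_mul_evanescentWave {κ : ℝ} (hκ : 0 < κ) (p : ℤ) {x : Plane}
    (hx : x ∈ Metric.ball (0 : Plane) 1) :
    ∫ y, aTilde p y * evanescentWave κ y x ∂cylMeasure κ =
      (2 * Real.pi * weightMoment κ (2 * p) : ℝ) * (Complex.I ^ p * circularWave κ p x) := by
  have hint : Integrable (fun y => aTilde p y * evanescentWave κ y x) (cylMeasure κ) :=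
    (memLp_aTilde hκ p).integrable_mul (memLp_evanescentWave hκ hx)
  rw [integral_cylMeasure, integral_prod_symm _ ((integrable_cylMeasure_iff κ _).1 hint)]
  have h (ζ : ℝ) : ∫ φ, weightSq κ ζ • (aTilde p (φ, ζ) * evanescentWave κ (φ, ζ) x) ∂angleMeasure =
      ((Real.exp (2 * p * ζ) * weightSq κ ζ : ℝ) : ℂ) *
        (2 * Real.pi * (Complex.I ^ p * circularWave κ p x)) := by
    have e (φ : Ico (0 : ℝ) (2 * Real.pi)) : aTilde p (φ, ζ) * evanescentWave κ (φ, ζ) x =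
        Complex.exp (p * ζ) * (Complex.exp (Complex.I * p * (φ : ℝ)) *
          Complex.exp (Complex.I * κ * (Complex.cos ((φ : ℝ) + Complex.I * ζ) * x 0 +
            Complex.sin ((φ : ℝ) + Complex.I * ζ) * x 1))) := by
      rw [aTilde, evanescentWave, mul_assoc]
    simp_rw [e]
    rw [integral_smul, integral_const_mul,
      integral_angleMeasure (fun φ : ℝ => Complex.exp (Complex.I * p * φ) *
          Complex.exp (Complex.I * κ * (Complex.cos (φ + Complex.I * ζ) * x 0 +
            Complex.sin (φ + Complex.I * ζ) * x 1))), integral_exp_mul_planeWave,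
      Complex.real_smul]
    have e2 : ((Real.exp (2 * p * ζ) : ℝ) : ℂ) = Complex.exp (p * ζ) * Complex.exp (p * ζ) := by
      rw [← Complex.exp_add]; push_cast; congr 1; ring
    rw [Complex.ofReal_mul, e2]
    ring
  simp_rw [h]
  rw [integral_mul_const, integral_complex_ofReal, weightMoment]
  push_cast
  ring

theorem summable_pow_natAbs_div_factorial (t : ℝ) :
    Summable fun p : ℤ => t ^ p.natAbs / (p.natAbs.factorial : ℝ) :=
  Summable.of_nat_of_neg (by simpa using Real.summable_pow_div_factorial t)
    (by simpa using Real.summable_pow_div_factorial t)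

theorem energyScale_le {κ : ℝ} (k : ℕ) :
    energyScale κ k ≤ 2 * ((κ ^ 2 / 4) ^ k / k.factorial) := by
  have h : ((k : ℝ) + 1) ≤ 2 * k.factorial := by
    have h1 : k ≤ k.factorial := Nat.self_le_factorial k
    have h2 : 1 ≤ k.factorial := Nat.factorial_pos k
    exact_mod_cast (by omega : k + 1 ≤ 2 * k.factorial)
  have h0 : (0 : ℝ) < k.factorial := by positivity
  rw [energyScale, pow_mul, show (κ / 2) ^ 2 = κ ^ 2 / 4 by ring]
  calc _ ≤ (κ ^ 2 / 4) ^ k * (2 * k.factorial) / (k.factorial : ℝ) ^ 2 := by gcongr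
    _ = _ := by field_simp

/-- The series of the reproducing kernel converges on the diagonal. -/
theorem summable_norm_herglotzPoly_sq {κ : ℝ} (hκ : 0 < κ) (y : Cyl) :
    Summable fun p : ℤ => ‖herglotzPoly κ p y‖ ^ 2 := by
  obtain ⟨c, _, hc, _, hb⟩ := exists_weightMoment_mul_circularEnergy_bounds hκ
  obtain ⟨_, C, _, hC, hE⟩ := exists_circularEnergy_bounds hκ
  refine Summable.of_nonneg_of_le (fun p => by positivity) (fun p => ?_)
    ((summable_pow_natAbs_div_factorial (Real.exp (2 * |y.2|) * (κ ^ 2 / 4))).mul_left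
      ((2 * Real.pi)⁻¹ * (C * 2 / c)))
  have hm := weightMoment_pos hκ (2 * p)
  have h1 : (weightMoment κ (2 * p))⁻¹ ≤
      C * 2 / c * ((κ ^ 2 / 4) ^ p.natAbs / p.natAbs.factorial) := by
    have h2 : circularEnergy κ p ≤ C * (2 * ((κ ^ 2 / 4) ^ p.natAbs / p.natAbs.factorial)) :=
      (hE p).2.trans (mul_le_mul_of_nonneg_left (energyScale_le _) hC.le)
    calc (weightMoment κ (2 * p))⁻¹ = c / (c * weightMoment κ (2 * p)) := by field_simp
      _ ≤ weightMoment κ (2 * p) * circularEnergy κ p / (c * weightMoment κ (2 * p)) := by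
          gcongr; exact (hb p).1
      _ = circularEnergy κ p / c := by field_simp
      _ ≤ C * (2 * ((κ ^ 2 / 4) ^ p.natAbs / p.natAbs.factorial)) / c := by gcongr
      _ = _ := by ring
  have h3 : Real.exp (2 * p * y.2) ≤ Real.exp (2 * |y.2|) ^ p.natAbs := by
    rw [← Real.exp_nat_mul, Real.exp_le_exp, Nat.cast_natAbs, Int.cast_abs]
    calc 2 * p * y.2 ≤ |2 * p * y.2| := le_abs_self _
      _ = _ := by rw [abs_mul, abs_mul, abs_two]; ring
  rw [herglotzPoly, norm_mul, mul_pow, norm_aTilde_sq, Complex.norm_real, Real.norm_eq_abs, sq_abs,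
    alpha_sq hκ, mul_inv]
  calc _ ≤ (2 * Real.pi)⁻¹ * (C * 2 / c * ((κ ^ 2 / 4) ^ p.natAbs / p.natAbs.factorial)) *
        Real.exp (2 * |y.2|) ^ p.natAbs := by gcongr
    _ = _ := by rw [mul_pow]; ring

/-! ### Diagonal operators, frame operators and evaluations on Hilbert spaces -/

section Hilbert

variable {ι V W : Type*} [NormedAddCommGroup V] [InnerProductSpace ℂ V]
  [NormedAddCommGroup W] [InnerProductSpace ℂ W]

/-- An orthonormal family is a Hilbert basis of its closed span. -/
theorem exists_hilbertBasis_of_closedSpan {e : ι → V} (he : Orthonormal ℂ e) (U : Submodule ℂ V)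
    (hU : U = (Submodule.span ℂ (range e)).topologicalClosure) [CompleteSpace U] :
    ∃ b : HilbertBasis ι ℂ U, ∀ i, (b i : V) = e i := by
  have hmem (i : ι) : e i ∈ U := by
    rw [hU]
    exact Submodule.le_topologicalClosure _ (Submodule.subset_span (mem_range_self i))
  set e' : ι → U := fun i => ⟨e i, hmem i⟩ with he'
  have ho : Orthonormal ℂ e' := he.codRestrict U hmem
  refine ⟨HilbertBasis.mkOfOrthogonalEqBot ho ?_, fun i => ?_⟩
  · rw [Submodule.eq_bot_iff]
    intro v hv
    have h1 : ∀ i, inner ℂ (e i) (v : V) = 0 := fun i =>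
      (Submodule.mem_orthogonal _ _).1 hv (e' i) (Submodule.subset_span (mem_range_self i))
    have h2 : Submodule.span ℂ (range e) ≤ (ℂ ∙ (v : V))ᗮ := by
      rw [Submodule.span_le]
      rintro _ ⟨i, rfl⟩
      rw [SetLike.mem_coe, Submodule.mem_orthogonal_singleton_iff_inner_left]
      exact h1 i
    have h3 : (v : V) ∈ (ℂ ∙ (v : V))ᗮ :=
      Submodule.topologicalClosure_minimal _ h2 (Submodule.isClosed_orthogonal _)
        (hU ▸ v.2)
    rw [Submodule.mem_orthogonal_singleton_iff_inner_left, inner_self_eq_zero] at h3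
    exact Subtype.ext h3
  · rw [HilbertBasis.coe_mkOfOrthogonalEqBot]

theorem memℓp_two_iff {f : ι → ℂ} : Memℓp f 2 ↔ Summable fun i => ‖f i‖ ^ 2 := by
  rw [memℓp_gen_iff (by norm_num)]
  norm_num

/-- Multiplication by a bounded family of numbers, on `ℓ²`. -/
def diagonalOp (c : ι → ℂ) (C : ℝ) (hc : ∀ i, ‖c i‖ ≤ C) :
    lp (fun _ : ι => ℂ) 2 →L[ℂ] lp (fun _ : ι => ℂ) 2 := by
  have hle (f : lp (fun _ : ι => ℂ) 2) (i : ι) : ‖c i * f i‖ ^ 2 ≤ C ^ 2 * ‖f i‖ ^ 2 := by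
    rw [norm_mul, mul_pow]
    gcongr
    exact hc i
  have hsum (f : lp (fun _ : ι => ℂ) 2) : Summable fun i => C ^ 2 * ‖f i‖ ^ 2 :=
    (memℓp_two_iff.1 (lp.memℓp f)).mul_left _
  refine LinearMap.mkContinuous
    { toFun := fun f => ⟨fun i => c i * f i, memℓp_two_iff.2
        (Summable.of_nonneg_of_le (fun i => by positivity) (hle f) (hsum f))⟩
      map_add' := fun f g => by ext i; exact mul_add _ _ _
      map_smul' := fun a f => by ext i; exact mul_left_comm _ _ _ } |C| fun f => ?_
  refine lp.norm_le_of_tsum_le (by norm_num) (by positivity) ?_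
  have h2 := lp.norm_rpow_eq_tsum (p := 2) (by norm_num) f
  norm_num at h2 ⊢
  rw [mul_pow, sq_abs, h2, ← tsum_mul_left]
  exact Summable.tsum_le_tsum (fun i => by simpa [mul_pow] using hle f i)
    (Summable.of_nonneg_of_le (fun i => by positivity)
      (fun i => by simpa [mul_pow] using hle f i) (hsum f)) (hsum f)

theorem diagonalOp_apply (c : ι → ℂ) (C : ℝ) (hc : ∀ i, ‖c i‖ ≤ C)
    (f : lp (fun _ : ι => ℂ) 2) (i : ι) : diagonalOp c C hc f i = c i * f i := rfl

/-- A diagonal operator with factors bounded above and below is an isomorphism. -/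
theorem exists_diagonal_operator (a : HilbertBasis ι ℂ V) (b : HilbertBasis ι ℂ W) (τ : ι → ℂ)
    {c C : ℝ} (hc : 0 < c) (hτ : ∀ i, c ≤ ‖τ i‖ ∧ ‖τ i‖ ≤ C) :
    ∃ (T : V →L[ℂ] W) (T' : W →L[ℂ] V), (∀ v, T' (T v) = v) ∧ (∀ w, T (T' w) = w) ∧
      ∀ i, T (a i) = τ i • b i := by
  classical
  have hne (i : ι) : τ i ≠ 0 := norm_pos_iff.1 (hc.trans_le (hτ i).1)
  have hinv (i : ι) : ‖(τ i)⁻¹‖ ≤ c⁻¹ := by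
    rw [norm_inv]; exact inv_anti₀ hc (hτ i).1
  let D : lp (fun _ : ι => ℂ) 2 ≃L[ℂ] lp (fun _ : ι => ℂ) 2 :=
    ContinuousLinearEquiv.equivOfInverse (diagonalOp τ C fun i => (hτ i).2)
      (diagonalOp (fun i => (τ i)⁻¹) c⁻¹ hinv)
      (fun f => by ext i; simp [diagonalOp_apply, hne i])
      (fun f => by ext i; simp [diagonalOp_apply, hne i])
  let E : V ≃L[ℂ] W :=
    (a.repr.toContinuousLinearEquiv.trans D).trans b.repr.symm.toContinuousLinearEquiv
  refine ⟨E, E.symm, E.symm_apply_apply, E.apply_symm_apply, fun i => ?_⟩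
  have h : D (a.repr (a i)) = τ i • b.repr (b i) := by
    rw [a.repr_self, b.repr_self]
    ext j
    change τ j * _ = τ i * _
    by_cases hij : j = i
    · subst hij; rfl
    · simp [lp.single_apply, hij]
  change b.repr.symm (D (a.repr (a i))) = _
  rw [h, map_smul, LinearIsometryEquiv.symm_apply_apply]

section Adjoint

variable [CompleteSpace V] [CompleteSpace W]

/-- An invertible synthesis operator `T` has an invertible frame operator `S = T T*`, with inverse
`(T⁻¹)* T⁻¹`, and a surjective analysis operator `T*`. -/
theorem exists_frameOperator {T : V →L[ℂ] W} {T' : W →L[ℂ] V} (hleft : ∀ v, T' (T v) = v)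
    (hright : ∀ w, T (T' w) = w) :
    ∃ S : W ≃L[ℂ] W, (S : W →L[ℂ] W) = T ∘L ContinuousLinearMap.adjoint T ∧
      range (ContinuousLinearMap.adjoint T) = univ ∧
      ∀ v w, inner ℂ (S.symm (T v)) (T w) = inner ℂ v w := by
  have h1 (v : V) : ContinuousLinearMap.adjoint T (ContinuousLinearMap.adjoint T' v) = v := by
    refine ext_inner_right ℂ fun w => ?_
    rw [ContinuousLinearMap.adjoint_inner_left, ContinuousLinearMap.adjoint_inner_left, hleft]
  have h2 (w : W) : ContinuousLinearMap.adjoint T' (ContinuousLinearMap.adjoint T w) = w := by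
    refine ext_inner_right ℂ fun v => ?_
    rw [ContinuousLinearMap.adjoint_inner_left, ContinuousLinearMap.adjoint_inner_left, hright]
  refine ⟨ContinuousLinearEquiv.equivOfInverse (T ∘L ContinuousLinearMap.adjoint T)
    (ContinuousLinearMap.adjoint T' ∘L T') (fun w => by simp [hleft, h2])
    (fun w => by simp [hright, h1]), rfl, range_eq_univ.2 fun v => ⟨_, h1 v⟩, fun v w => ?_⟩
  change inner ℂ (ContinuousLinearMap.adjoint T' (T' (T v))) (T w) = _
  rw [ContinuousLinearMap.adjoint_inner_left, hleft, hleft]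

end Adjoint

/-- If pointwise evaluations by continuous functionals give representatives of the `L²` classes of
the elements of a Hilbert basis, then they do so for all elements. -/
theorem ae_eq_of_hilbertBasis {X : Type*} [MeasurableSpace X] {μ : Measure X}
    (b : HilbertBasis ι ℂ V) (L : V →L[ℂ] Lp ℂ 2 μ) (ev : X → V →L[ℂ] ℂ)
    (h : ∀ i, L (b i) =ᵐ[μ] fun x => ev x (b i)) (v : V) : L v =ᵐ[μ] fun x => ev x v := by
  have hspan : ∀ w ∈ Submodule.span ℂ (range b), L w =ᵐ[μ] fun x => ev x w := by
    intro w hw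
    induction hw using Submodule.span_induction with
    | mem w hw => obtain ⟨i, rfl⟩ := hw; exact h i
    | zero =>
      simp only [map_zero]
      exact Lp.coeFn_zero ℂ 2 μ
    | add w₁ w₂ _ _ h₁ h₂ =>
      rw [map_add]
      filter_upwards [Lp.coeFn_add (L w₁) (L w₂), h₁, h₂] with x hx hx₁ hx₂
      rw [hx, Pi.add_apply, hx₁, hx₂, map_add]
    | smul c w _ hw =>
      rw [map_smul]
      filter_upwards [Lp.coeFn_smul c (L w), hw] with x hx hx'
      rw [hx, Pi.smul_apply, hx', map_smul]
  have hv : v ∈ closure (Submodule.span ℂ (range b) : Set V) := by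
    have := b.dense_span
    rw [← Submodule.topologicalClosure_coe, this]
    trivial
  obtain ⟨s, hs, hlim⟩ := mem_closure_iff_seq_limit.1 hv
  have hLp : Filter.Tendsto (fun n => L (s n)) Filter.atTop (nhds (L v)) :=
    (L.continuous.tendsto v).comp hlim
  obtain ⟨k, hk, hae⟩ := (tendstoInMeasure_of_tendsto_Lp hLp).exists_seq_tendsto_ae
  filter_upwards [hae, ae_all_iff.2 fun n => hspan (s n) (hs n)] with x hx hx'
  refine tendsto_nhds_unique hx ?_
  simp_rw [hx']
  exact ((ev x).continuous.tendsto v).comp (hlim.comp hk.tendsto_atTop)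

/-- The element of a Hilbert space with prescribed square summable coefficients. -/
theorem exists_hasSum_of_summable_sq (b : HilbertBasis ι ℂ V) {c : ι → ℂ}
    (hc : Summable fun i => ‖c i‖ ^ 2) :
    ∃ v : V, (∀ i, inner ℂ (b i) v = c i) ∧ (∀ i, inner ℂ v (b i) = conj (c i)) ∧
      HasSum (fun i => c i • b i) v := by
  let f : lp (fun _ : ι => ℂ) 2 := ⟨c, memℓp_two_iff.2 hc⟩
  have h (i : ι) : inner ℂ (b i) (b.repr.symm f) = c i := by
    rw [← b.repr_apply_apply, LinearIsometryEquiv.apply_symm_apply]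
  exact ⟨b.repr.symm f, h, fun i => by rw [← inner_conj_symm, h], b.hasSum_repr_symm f⟩

/-- A family of vectors that separates the points makes a Hilbert space a reproducing kernel
Hilbert space. -/
abbrev rkhsOfFamily {X : Type*} (K : X → V)
    (hK : ∀ v w, (∀ x, inner ℂ (K x) v = inner ℂ (K x) w) → v = w) : RKHS ℂ V X ℂ where
  coeCLM := ContinuousLinearMap.pi fun x => innerSL ℂ (K x)
  coeCLM_injective := fun v w h => hK v w fun x => congrFun h x

theorem rkhsOfFamily_kernel [CompleteSpace V] {X : Type*} (K : X → V)
    (hK : ∀ v w, (∀ x, inner ℂ (K x) v = inner ℂ (K x) w) → v = w) (x y : X) :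
    letI := rkhsOfFamily K hK
    RKHS.kernel V x y 1 = inner ℂ (K x) (K y) := by
  let := rkhsOfFamily K hK
  have h : RKHS.kerFun V y (1 : ℂ) = K y := by
    refine ext_inner_right ℂ fun v => ?_
    rw [RKHS.kerFun_inner, RCLike.inner_apply, map_one, mul_one]
    rfl
  rw [← RKHS.kerFun_apply, h]
  rfl

end Hilbert

/-! ### The Herglotz transform -/

theorem circularEnergy_pos {κ : ℝ} (hκ : 0 < κ) (p : ℤ) : 0 < circularEnergy κ p := by
  obtain ⟨c, _, hc, _, hE⟩ := exists_circularEnergy_bounds hκ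
  refine lt_of_lt_of_le (mul_pos hc ?_) (hE p).1
  unfold energyScale
  positivity

/-- The normalized circular waves. -/
def circularUnit (κ : ℝ) (p : ℤ) : H1 κ :=
  ((√(circularEnergy κ p))⁻¹ : ℂ) • circularH1 κ p

theorem sqrt_circularEnergy_ne_zero {κ : ℝ} (hκ : 0 < κ) (p : ℤ) :
    (√(circularEnergy κ p) : ℂ) ≠ 0 := by
  exact_mod_cast (Real.sqrt_pos.2 (circularEnergy_pos hκ p)).ne'

theorem orthonormal_circularUnit {κ : ℝ} (hκ : 0 < κ) : Orthonormal ℂ (circularUnit κ) := by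
  rw [orthonormal_iff_ite]
  intro p q
  have hin : inner ℂ (circularUnit κ p) (circularUnit κ q) =
      conj ((√(circularEnergy κ p))⁻¹ : ℂ) * (((√(circularEnergy κ q))⁻¹ : ℂ) *
        inner ℂ (circularH1 κ p) (circularH1 κ q)) :=
    (inner_smul_left (𝕜 := ℂ) (E := H1 κ) _ _ _).trans
      (congrArg _ (inner_smul_right (𝕜 := ℂ) (E := H1 κ) _ _ _))
  rw [hin, inner_circularH1]
  split_ifs with h
  · subst h
    have h1 := sqrt_circularEnergy_ne_zero hκ p
    have h2 : (circularEnergy κ p : ℂ) = √(circularEnergy κ p) * √(circularEnergy κ p) := by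
      rw [← Complex.ofReal_mul, Real.mul_self_sqrt (circularEnergy_pos hκ p).le]
    rw [map_inv₀, Complex.conj_ofReal, h2]
    field_simp
  · simp

theorem helmholtzSpace_eq_span_circularUnit {κ : ℝ} (hκ : 0 < κ) :
    HelmholtzSpace κ = (Submodule.span ℂ (range (circularUnit κ))).topologicalClosure := by
  rw [helmholtzSpace_eq hκ]
  congr 1
  refine le_antisymm (Submodule.span_le.2 ?_) (Submodule.span_le.2 ?_)
  · rintro _ ⟨p, rfl⟩
    have : circularH1 κ p = (√(circularEnergy κ p) : ℂ) • circularUnit κ p := by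
      rw [circularUnit, smul_inv_smul₀ (sqrt_circularEnergy_ne_zero hκ p)]
    rw [this]
    exact Submodule.smul_mem _ _ (Submodule.subset_span (mem_range_self p))
  · rintro _ ⟨p, rfl⟩
    exact Submodule.smul_mem _ _ (Submodule.subset_span (mem_range_self p))

/-- The factors by which the Herglotz transform acts on the orthonormal bases. -/
def herglotzFactor (κ : ℝ) (p : ℤ) : ℂ :=
  Complex.I ^ p * √(circularEnergy κ p) / alpha κ p

theorem norm_herglotzFactor_sq {κ : ℝ} (hκ : 0 < κ) (p : ℤ) :
    ‖herglotzFactor κ p‖ ^ 2 = 2 * Real.pi * (weightMoment κ (2 * p) * circularEnergy κ p) := by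
  have h := alpha_pos hκ p
  rw [herglotzFactor, norm_div, norm_mul, norm_zpow, Complex.norm_I, one_zpow, one_mul,
    Complex.norm_real, Complex.norm_real, Real.norm_eq_abs, Real.norm_eq_abs, div_pow, sq_abs,
    sq_abs, alpha_sq hκ, Real.sq_sqrt (circularEnergy_pos hκ p).le, div_inv_eq_mul]
  ring

theorem exists_herglotzFactor_bounds {κ : ℝ} (hκ : 0 < κ) : ∃ c C : ℝ, 0 < c ∧
    ∀ p, c ≤ ‖herglotzFactor κ p‖ ∧ ‖herglotzFactor κ p‖ ≤ C := by
  obtain ⟨c, C, hc, hC, hb⟩ := exists_weightMoment_mul_circularEnergy_bounds hκ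
  refine ⟨√(2 * Real.pi * c), √(2 * Real.pi * C), by positivity, fun p => ⟨?_, ?_⟩⟩
  · rw [Real.sqrt_le_left (norm_nonneg _), norm_herglotzFactor_sq hκ]
    have := (hb p).1
    gcongr
  · refine Real.le_sqrt_of_sq_le ?_
    rw [norm_herglotzFactor_sq hκ]
    have := (hb p).2
    gcongr

open Classical in
/-- The Herglotz integral at a point `x` of the disk, as a functional of the density. -/
def herglotzIntegral {κ : ℝ} (hκ : 0 < κ) (x : Plane) : HerglotzDensities κ →L[ℂ] ℂ :=
  if hx : x ∈ Metric.ball (0 : Plane) 1 then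
    innerSL ℂ ((memLp_evanescentWave hκ hx).star.toLp _) ∘L (HerglotzDensities κ).subtypeL
  else 0

theorem herglotzIntegral_apply {κ : ℝ} (hκ : 0 < κ) {x : Plane}
    (hx : x ∈ Metric.ball (0 : Plane) 1) (v : HerglotzDensities κ) :
    herglotzIntegral hκ x v = ∫ y, v.1 y * evanescentWave κ y x ∂cylMeasure κ := by
  rw [herglotzIntegral, dif_pos hx]
  change inner ℂ ((memLp_evanescentWave hκ hx).star.toLp _) v.1 = _
  rw [L2.inner_def]
  refine integral_congr_ae ?_
  filter_upwards [(memLp_evanescentWave hκ hx).star.coeFn_toLp] with y hy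
  rw [hy, RCLike.inner_apply]
  simp

theorem herglotzIntegral_herglotzPoly {κ : ℝ} (hκ : 0 < κ) {x : Plane}
    (hx : x ∈ Metric.ball (0 : Plane) 1) {v : HerglotzDensities κ} {p : ℤ}
    (hv : v.1 =ᵐ[cylMeasure κ] herglotzPoly κ p) :
    herglotzIntegral hκ x v = Complex.I ^ p / alpha κ p * circularWave κ p x := by
  have h : ∫ y, v.1 y * evanescentWave κ y x ∂cylMeasure κ =
      ∫ y, alpha κ p * (aTilde p y * evanescentWave κ y x) ∂cylMeasure κ := by
    refine integral_congr_ae ?_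
    filter_upwards [hv] with y hy
    rw [hy, herglotzPoly, mul_assoc]
  have h1 : (alpha κ p : ℂ) ≠ 0 := by exact_mod_cast (alpha_pos hκ p).ne'
  have h2 : 2 * Real.pi * weightMoment κ (2 * p) = (alpha κ p ^ 2)⁻¹ := by
    rw [alpha_sq hκ, inv_inv]
  rw [herglotzIntegral_apply hκ hx, h, integral_const_mul,
    integral_aTilde_mul_evanescentWave hκ p hx, h2]
  push_cast
  field_simp

/-- The Herglotz polynomials as a Hilbert basis of the space of Herglotz densities. -/
theorem exists_herglotzBasis {κ : ℝ} (hκ : 0 < κ) :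
    ∃ a : HilbertBasis ℤ ℂ (HerglotzDensities κ),
      ∀ p, (a p).1 =ᵐ[cylMeasure κ] herglotzPoly κ p := by
  obtain ⟨a, ha⟩ := exists_hilbertBasis_of_closedSpan (orthonormal_herglotzLp hκ)
    (HerglotzDensities κ) (herglotzDensities_eq hκ)
  refine ⟨a, fun p => ?_⟩
  rw [ha]
  exact (memLp_herglotzPoly hκ p).coeFn_toLp

/-- The element of `L²` of the disk underlying an element of the Helmholtz solution space. -/
def helmholtzToL2 (κ : ℝ) : HelmholtzSpace κ →L[ℂ] DiskL2 :=
  WithLp.fstL 2 ℂ DiskL2 DiskL2Vec ∘L (H1 κ).subtypeL ∘L (HelmholtzSpace κ).subtypeL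

/-- The isomorphism that is diagonal in the orthonormal bases is given by the Herglotz integral. -/
theorem exists_herglotzOperator {κ : ℝ} (hκ : 0 < κ) (a : HilbertBasis ℤ ℂ (HerglotzDensities κ))
    (ha : ∀ p, (a p).1 =ᵐ[cylMeasure κ] herglotzPoly κ p) :
    ∃ (T : HerglotzDensities κ →L[ℂ] HelmholtzSpace κ)
      (T' : HelmholtzSpace κ →L[ℂ] HerglotzDensities κ),
      (∀ v, T' (T v) = v) ∧ (∀ w, T (T' w) = w) ∧
      ∀ v, IsClassOf (T v).1 fun x => herglotzIntegral hκ x v := by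
  obtain ⟨b, hb⟩ := exists_hilbertBasis_of_closedSpan (orthonormal_circularUnit hκ)
    (HelmholtzSpace κ) (helmholtzSpace_eq_span_circularUnit hκ)
  obtain ⟨c, C, hc, hτ⟩ := exists_herglotzFactor_bounds hκ
  obtain ⟨T, T', hleft, hright, hT⟩ := exists_diagonal_operator a b (herglotzFactor κ) hc hτ
  have hTa (p : ℤ) : (T (a p)).1 = (Complex.I ^ p / alpha κ p) • circularH1 κ p := by
    rw [hT, Submodule.coe_smul, hb, circularUnit, smul_smul, herglotzFactor]
    have h1 := sqrt_circularEnergy_ne_zero hκ p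
    congr 1
    field_simp
  refine ⟨T, T', hleft, hright, ae_eq_of_hilbertBasis a (helmholtzToL2 κ ∘L T)
    (herglotzIntegral hκ) fun p => ?_⟩
  change (T (a p)).1.1.fst =ᵐ[diskMeasure] _
  rw [hTa]
  change ((Complex.I ^ p / alpha κ p) • (circularH1 κ p).1.fst : DiskL2) =ᵐ[diskMeasure] _
  filter_upwards [Lp.coeFn_smul (Complex.I ^ p / alpha κ p : ℂ) (circularH1 κ p).1.fst,
    isClassOf_circularH1 κ p, ae_restrict_mem Metric.isOpen_ball.measurableSet] with x h1 h2 hx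
  rw [h1, Pi.smul_apply, h2, herglotzIntegral_herglotzPoly hκ hx (ha p), smul_eq_mul]

/-- Vectors `K y` with the Fourier coefficients `conj (a_p y)` represent the classes in
`L²(w² dy)` pointwise. -/
theorem inner_family_ae_eq {κ : ℝ} {a : HilbertBasis ℤ ℂ (HerglotzDensities κ)}
    (ha : ∀ p, (a p).1 =ᵐ[cylMeasure κ] herglotzPoly κ p) {K : Cyl → HerglotzDensities κ}
    (hK : ∀ y p, inner ℂ (K y) (a p) = herglotzPoly κ p y) (v : HerglotzDensities κ) :
    (fun y => inner ℂ (K y) v) =ᵐ[cylMeasure κ] v.1 := by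
  refine (ae_eq_of_hilbertBasis a (HerglotzDensities κ).subtypeL
    (fun y => innerSL ℂ (K y)) (fun p => (ha p).trans ?_) v).symm
  exact Filter.Eventually.of_forall fun y => (hK y p).symm

end EvanescentWaves

end

open EvanescentWaves MeasureTheory
theorem proposition5p1 (κ : ℝ) (hκ : 0 < κ) :
    ∃ (T : HerglotzDensities κ →L[ℂ] HelmholtzSpace κ) (S : HelmholtzSpace κ ≃L[ℂ] HelmholtzSpace κ)
      (Φ : Cyl → HelmholtzSpace κ) (R : RKHS ℂ (HerglotzDensities κ) Cyl ℂ)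
      (K : Cyl → HerglotzDensities κ),
      -- `T` is the Herglotz transform, `S = T T*` the (invertible) frame operator,
      -- `Φ y` is the evanescent plane wave with parameter `y`
      IsHerglotzTransform T ∧
      (S : HelmholtzSpace κ →L[ℂ] HelmholtzSpace κ) = T ∘L analysisOp T ∧
      (∀ y, IsClassOf (Φ y).1 (evanescentWave κ y)) ∧
      -- the range of the analysis operator is the whole space of Herglotz densities
      Set.range (analysisOp T) = Set.univ ∧
      -- the realization of Herglotz densities as functions on the cylinder is the one given by
      -- the analysis operator, and consists of representatives of the `L²` classes
      (∀ u y, RKHS.coeCLM ℂ (analysisOp T u) y = inner ℂ (Φ y) u) ∧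
      (∀ v : HerglotzDensities κ, RKHS.coeCLM ℂ v =ᵐ[cylMeasure κ] v.1) ∧
      -- `K y` is the unique Riesz representative of the evaluation at `y`
      (∀ y (v : HerglotzDensities κ), RKHS.coeCLM ℂ v y = inner ℂ (K y) v) ∧
      (∀ y k, (∀ v : HerglotzDensities κ, RKHS.coeCLM ℂ v y = inner ℂ k v) → k = K y) ∧
      -- formulas for the reproducing kernel
      (∀ y z, RKHS.kernel (HerglotzDensities κ) z y 1 = RKHS.coeCLM ℂ (K y) z) ∧
      (∀ y z, RKHS.coeCLM ℂ (K y) z = inner ℂ (K z) (K y)) ∧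
      (∀ y z, RKHS.coeCLM ℂ (K y) z = inner ℂ (S.symm (Φ z)) (Φ y)) ∧
      (∀ y z, HasSum
        (fun p : ℤ => starRingEnd ℂ (herglotzPoly κ p y) * herglotzPoly κ p z)
        (RKHS.coeCLM ℂ (K y) z)) ∧
      -- point evaluations are continuous
      (∀ y, Continuous fun v : HerglotzDensities κ => RKHS.coeCLM ℂ v y) := by
  obtain ⟨a, ha⟩ := exists_herglotzBasis hκ
  obtain ⟨T, T', hleft, hright, hclass⟩ := exists_herglotzOperator hκ a ha
  obtain ⟨S, hS, hrange, hinner⟩ :=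
    exists_frameOperator (V := HerglotzDensities κ) (W := HelmholtzSpace κ) hleft hright
  have hHerglotz : IsHerglotzTransform T := by
    refine fun v => ⟨fun x hx => (Lp.memLp v.1).integrable_mul (memLp_evanescentWave hκ hx), ?_⟩
    refine (hclass v).trans ?_
    filter_upwards [ae_restrict_mem Metric.isOpen_ball.measurableSet] with x hx
    exact herglotzIntegral_apply hκ hx v
  -- The reproducing kernel functions are given by their coefficients in the basis `a`.
  choose K hKa hKa₂ hKsum using fun y : Cyl =>
    exists_hasSum_of_summable_sq a (c := fun p => starRingEnd ℂ (herglotzPoly κ p y))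
      (by simpa using summable_norm_herglotzPoly_sq hκ y)
  have hKa' (y : Cyl) (p : ℤ) : inner ℂ (K y) (a p) = herglotzPoly κ p y := by
    rw [hKa₂, Complex.conj_conj]
  have hrepr := inner_family_ae_eq ha hKa'
  have hinj (v w : HerglotzDensities κ) (h : ∀ y, inner ℂ (K y) v = inner ℂ (K y) w) : v = w := by
    have hvw : (fun y => inner ℂ (K y) v) =ᵐ[cylMeasure κ] fun y => inner ℂ (K y) w :=
      Filter.Eventually.of_forall h
    exact Subtype.ext (Lp.ext ((hrepr v).symm.trans (hvw.trans (hrepr w))))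
  have hadj (u : HelmholtzSpace κ) (y : Cyl) :
      inner ℂ (K y) (analysisOp T u) = inner ℂ (T (K y)) u :=
    ContinuousLinearMap.adjoint_inner_right _ _ _
  refine ⟨T, S, fun y => T (K y), rkhsOfFamily K hinj, K, hHerglotz, hS, ?_, hrange,
    fun u y => hadj u y, hrepr, fun y v => rfl, ?_, ?_, fun y z => rfl,
    fun y z => (hinner (K z) (K y)).symm, ?_, ?_⟩
  · -- The Jacobi–Anger expansion identifies `T (K y)` with a plane wave.
    intro y
    refine (hclass (K y)).trans ?_
    filter_upwards [ae_restrict_mem Metric.isOpen_ball.measurableSet] with x hx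
    have h := (hKsum y).mapL (herglotzIntegral hκ x)
    refine h.unique ((hasSum_evanescentWave κ y x).congr_fun fun p => ?_)
    have h1 : (alpha κ p : ℂ) ≠ 0 := by exact_mod_cast (alpha_pos hκ p).ne'
    rw [map_smul, herglotzIntegral_herglotzPoly hκ hx (ha p), herglotzPoly, map_mul,
      Complex.conj_ofReal, smul_eq_mul]
    field_simp
  · exact fun y k hk => ext_inner_right ℂ fun v => (hk v).symm
  · exact fun y z => rkhsOfFamily_kernel K hinj z y
  · intro y z
    refine (a.hasSum_inner_mul_inner (K z) (K y)).congr_fun fun p => ?_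
    rw [hKa', hKa, mul_comm]
  · exact fun y => (innerSL ℂ (K y)).continuous
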